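/- Theorem 4 (Estimation of the Variance Matrix). Consider the model $Y_{it}=f(X_t)+\varepsilon_{it}$, $i=1,\dots,n$, $t=1,\dots,T$, with deterministic $X_t$ in a compact set $\mathcal X\subset\mathbb R^d$, along an asymptotic regime $n,T\to\infty$ in which the error distributions, the points $X_t$, the number $P$ of basis functions, the number $R\ge 1$ of restrictions, the functional $\Gamma$ and the matrix $\widetilde\Psi$ below may change. Write $\varepsilon_i=(\varepsilon_{i1},\dots,\varepsilon_{iT})'$, $Y_i=(Y_{i1},\dots,Y_{iT})'$, $f(\mathbf X)=(f(X_1),\dots,f(X_T))'$, $|g|_s=\max_{|a|\le s}\sup_{x\in\mathcal X}|\partial^a g(x)|$, and let $W_{s,\infty}$ be the space of functions with $s$ continuous derivatives on $\mathcal X$ and $|g|_s<\infty$. For each $P$ let $\psi_P=(\psi_{1,P},\dots,\psi_{P,P})$ be given basis functions, let $\Psi$ be the $T\times P$ matrix with rows $\psi_P(X_t)$, and put $\zeta_s(P)=\max_{|a|\le s}\sup_{x\in\mathcal X}\|\partial^a\psi_P(x)\|$, $\hat\beta=(\Psi'\Psi)^{-1}\Psi'\frac1n\sum_iY_i$, $\hat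 f_P=\psi_P\hat\beta$, $\beta_0=(\Psi'\Psi)^{-1}\Psi'f(\mathbf X)$, $N_P=|f-\psi_P\beta_0|_s$. Let $\lambda_{\min},\lambda_{\max}$ denote extreme eigenvalues. Assume, for integers $0\le s\le c$: 1. For all $n,T$, the random vectors $\varepsilon_1,\dots,\varepsilon_n$ are independent, with mean $0$ and finite, positive definite covariance matrices $\Sigma_i=\mathbb E\,\varepsilon_i\varepsilon_i'$; put $\bar\Sigma=\frac1n\sum_i\Sigma_i$. 2. $\|\Psi'\Psi/T-Q_P\|_F\to0$ for positive definite matrices $Q_P$ whose smallest eigenvalues are bounded away from $0$. For every $r\ge0$, the functions $\psi_{j,P}$ lie in $W_{r,\infty}$, and $\zeta_r(P)\ge1$ for all large $P$. 3. $\zeta_s(P)\big(\min(P\lambda_{\max}(\bar\Sigma),\operatorname{tr}\bar\Sigma)/(nT)\big)^{1/2}\to0$. Further, $N_P\to0$ if $s=0$, and $\zeta_s(P)N_P\to0$ if $s>0$. 4. $f\in W_{c,\infty}$, and $\widetilde\Psi$ is an $R\times P$ matrix with $\lambda_{\min}(\widetilde\Psi\widetilde\Psi')>0$. 5. One of the following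 holds. (Linear case) $\Gamma$ is linear on $W_{s,\infty}$ with values in $\mathbb R^R$; $\Gamma(\psi_P\beta)=\widetilde\Psi\beta$ for all $\beta$; and $\|\Gamma(g)\|\le C_3|g|_s$ on $W_{s,\infty}$, for some $C_3>0$ that may depend on $n,T,R$. Put $\Lambda=\Gamma$. (Nonlinear case) There is a $\delta>0$ such that the moments $\mathbb E|\varepsilon_{it}|^{2+\delta}$ are eventually finite and $T^{1+\delta/2}\max_{i,t}\mathbb E|\varepsilon_{it}|^{2+\delta}/(n^{\delta/2}\lambda_{\min}(\bar\Sigma)^{1+\delta/2})\to0$; for all $n,T$, $\lambda_{\min}(\bar\Sigma)>0$; and $\Gamma$ has a directional derivative $\Gamma'(g;h)$ such that: it is linear in $g\in W_{s,\infty}$ for every $h\in W_{s,\infty}$; $\Gamma'(\psi_P\beta;f)=\widetilde\Psi\beta$ for all $\beta$; for some $C_4,C_5,\epsilon>0$ and all $g,h\in W_{s,\infty}$ with $|f-g|_s<\epsilon$ and $|f-h|_s<\epsilon$, $\|\Gamma(f)-\Gamma(g)-\Gamma'(f-g;g)\|\le C_4|f-g|_s^2$ and $\|\Gamma'(f;g)-\Gamma'(f;h)\|\le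 C_5|f|_s|g-h|_s$; and for some $C_6>0$, $\|\Gamma'(g;f)\|\le C_6|g|_s$ for all $g\in W_{s,\infty}$. Put $\Lambda=\Gamma'(\cdot;f)$. For a $T\times T$ matrix $M$ put $V(M)=\frac1n\widetilde\Psi(\Psi'\Psi)^{-1}\Psi'M\Psi(\Psi'\Psi)^{-1}\widetilde\Psi'$ and $\overline W(M)=V(M)^{-1/2}\big(\Lambda(\hat f_P)-\mathbb E\Lambda(\hat f_P)\big)$. Let $\overline W_{nT}=\overline W(\bar\Sigma)$. With the residuals $\hat U_i=Y_i-\Psi\hat\beta$ and $\widehat{\bar\Sigma}=\frac1n\sum_i\hat U_i\hat U_i'$, let $\widehat{\overline W}_{nT}=\overline W(\widehat{\bar\Sigma})$. If the fourth moments of the errors are eventually finite and $$\frac{\lambda_{\max}(\widetilde\Psi\widetilde\Psi')}{\lambda_{\min}(\widetilde\Psi\widetilde\Psi')}\,\frac{T(1\vee\ln R)\sqrt{\max_{i,t}\mathbb E\varepsilon_{it}^4}}{\sqrt n\,\lambda_{\min}(\bar\Sigma)}\to0,$$ then $$\frac{\widehat{\overline W}_{nT}'\widehat{\overline W}_{nT}-R}{\sqrt{2R}}=\frac{\overline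 W_{nT}'\overline W_{nT}-R}{\sqrt{2R}}+O_{\mathbb P}\!\left(\frac{\lambda_{\max}(\widetilde\Psi\widetilde\Psi')}{\lambda_{\min}(\widetilde\Psi\widetilde\Psi')}\,\frac{T\sqrt R\,(1\vee\ln R)\sqrt{\max_{i,t}\mathbb E\varepsilon_{it}^4}}{\lambda_{\min}(\bar\Sigma)\sqrt n}\right).$$ -/

import Mathlib

open MeasureTheory ProbabilityTheory Filter Topology Matrix

noncomputable section

/-! ### Linear algebra -/

/-- Largest eigenvalue of a real symmetric matrix. -/
def lambdaMax {m : ℕ} (A : Matrix (Fin m) (Fin m) ℝ) : ℝ := sSup (spectrum ℝ A)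

/-- Smallest eigenvalue of a real symmetric matrix. -/
def lambdaMin {m : ℕ} (A : Matrix (Fin m) (Fin m) ℝ) : ℝ := sInf (spectrum ℝ A)

/-- Frobenius norm. -/
def frobNorm {m p : ℕ} (A : Matrix (Fin m) (Fin p) ℝ) : ℝ := √(∑ i, ∑ j, A i j ^ 2)

/-- `V^{-1/2}`: for a positive definite `V`, the symmetric positive definite square root of `V⁻¹`
(spectral calculus). -/
def invSqrt {m : ℕ} (V : Matrix (Fin m) (Fin m) ℝ) : Matrix (Fin m) (Fin m) ℝ :=
  cfc (fun x : ℝ => (√x)⁻¹) V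

/-! ### Stochastic boundedness -/

/-- `X_k = O_P(a_k)` along the filter `l`; the `X_k` may live on different probability spaces. -/
def IsBigOP {ι : Type*} (l : Filter ι) {Ω : ι → Type*} [∀ k, MeasurableSpace (Ω k)]
    (μ : ∀ k, Measure (Ω k)) (X : ∀ k, Ω k → ℝ) (a : ι → ℝ) : Prop :=
  ∀ η : ℝ, 0 < η → ∃ M : ℝ, 0 < M ∧
    ∀ᶠ k in l, μ k {ω | M * |a k| < |X k ω|} ≤ ENNReal.ofReal η

/-! ### Sobolev sup-norms on the set of stimuli -/

/-- First partial derivative in the `j`-th coordinate, on the set `S`. -/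
def partialDeriv {d : ℕ} (S : Set (EuclideanSpace ℝ (Fin d))) (j : Fin d)
    (g : EuclideanSpace ℝ (Fin d) → ℝ) : EuclideanSpace ℝ (Fin d) → ℝ :=
  fun x => fderivWithin ℝ g S x (EuclideanSpace.single j 1)

/-- The derivative `∂^a g` for a multi-index `a`, on the set `S`. -/
def multiDeriv {d : ℕ} (S : Set (EuclideanSpace ℝ (Fin d))) (a : Fin d → ℕ)
    (g : EuclideanSpace ℝ (Fin d) → ℝ) : EuclideanSpace ℝ (Fin d) → ℝ :=
  (List.finRange d).foldr (fun j h => (partialDeriv S j)^[a j] h) g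

/-- All values `|∂^a g (x)|` with `|a| ≤ s` and `x ∈ S`. -/
def derivValues {d : ℕ} (S : Set (EuclideanSpace ℝ (Fin d))) (s : ℕ)
    (g : EuclideanSpace ℝ (Fin d) → ℝ) : Set ℝ :=
  {r | ∃ a : Fin d → ℕ, ∑ j, a j ≤ s ∧ ∃ x ∈ S, r = |multiDeriv S a g x|}

/-- `|g|_s = max_{|a| ≤ s} sup_{x ∈ S} |∂^a g (x)|`. -/
def sobNorm {d : ℕ} (S : Set (EuclideanSpace ℝ (Fin d))) (s : ℕ)
    (g : EuclideanSpace ℝ (Fin d) → ℝ) : ℝ := sSup (derivValues S s g)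

/-- `g ∈ W_{s,∞}`: `g` has `s` continuous derivatives on `S` and `|g|_s < ∞`. -/
def MemSob {d : ℕ} (S : Set (EuclideanSpace ℝ (Fin d))) (s : ℕ)
    (g : EuclideanSpace ℝ (Fin d) → ℝ) : Prop :=
  ContDiffOn ℝ (s : WithTop ℕ∞) g S ∧ BddAbove (derivValues S s g)

/-! ### Sieve basis -/

/-- `f_P(x) = ψ_P(x) β`. -/
def sieveFun {d p : ℕ} (ψ : Fin p → EuclideanSpace ℝ (Fin d) → ℝ) (β : Fin p → ℝ) :
    EuclideanSpace ℝ (Fin d) → ℝ := fun x => ∑ j, ψ j x * β j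

/-- `ζ_s(P) = max_{|a| ≤ s} sup_{x ∈ S} ‖∂^a ψ_P(x)‖_F`. -/
def zeta {d p : ℕ} (S : Set (EuclideanSpace ℝ (Fin d))) (s : ℕ)
    (ψ : Fin p → EuclideanSpace ℝ (Fin d) → ℝ) : ℝ :=
  sSup {r | ∃ a : Fin d → ℕ, ∑ j, a j ≤ s ∧ ∃ x ∈ S, r = √(∑ j, multiDeriv S a (ψ j) x ^ 2)}

/-- The `T × P` design matrix `Ψ` with rows `ψ_P(X_t)`. -/
def designMatrix {d p T : ℕ} (ψ : Fin p → EuclideanSpace ℝ (Fin d) → ℝ)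
    (X : Fin T → EuclideanSpace ℝ (Fin d)) : Matrix (Fin T) (Fin p) ℝ :=
  Matrix.of fun t j => ψ j (X t)

/-- Least-squares coefficients `(Ψ'Ψ)⁻¹ Ψ' y`. -/
def lsCoef {T p : ℕ} (Ψ : Matrix (Fin T) (Fin p) ℝ) (y : Fin T → ℝ) : Fin p → ℝ :=
  (Ψᵀ * Ψ)⁻¹ *ᵥ (Ψᵀ *ᵥ y)

/-! ### The model `Y_{it} = f(X_t) + ε_{it}` and its estimators -/

/-- The observation vector `Y_i`. -/
def obs {d n T : ℕ} {Ω : Type*} (f : EuclideanSpace ℝ (Fin d) → ℝ)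
    (X : Fin T → EuclideanSpace ℝ (Fin d)) (ε : Fin n → Fin T → Ω → ℝ)
    (i : Fin n) (ω : Ω) : Fin T → ℝ := fun t => f (X t) + ε i t ω

/-- `β̂ = (Ψ'Ψ)⁻¹ Ψ' Ȳ`, where `Ȳ = (1/n) ∑ Y_i`. -/
def betaHat {d n T p : ℕ} {Ω : Type*} (f : EuclideanSpace ℝ (Fin d) → ℝ)
    (ψ : Fin p → EuclideanSpace ℝ (Fin d) → ℝ)
    (X : Fin T → EuclideanSpace ℝ (Fin d)) (ε : Fin n → Fin T → Ω → ℝ) (ω : Ω) : Fin p → ℝ :=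
  lsCoef (designMatrix ψ X) ((n : ℝ)⁻¹ • ∑ i, obs f X ε i ω)

/-- The sieve estimator `f̂_P(x) = ψ_P(x) β̂`. -/
def fHat {d n T p : ℕ} {Ω : Type*} (f : EuclideanSpace ℝ (Fin d) → ℝ)
    (ψ : Fin p → EuclideanSpace ℝ (Fin d) → ℝ)
    (X : Fin T → EuclideanSpace ℝ (Fin d)) (ε : Fin n → Fin T → Ω → ℝ) (ω : Ω) :
    EuclideanSpace ℝ (Fin d) → ℝ := sieveFun ψ (betaHat f ψ X ε ω)

/-- `f_{P,0}(x) = ψ_P(x) β₀`, where `β₀ = (Ψ'Ψ)⁻¹ Ψ' f(X)`. -/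
def fZero {d T p : ℕ} (f : EuclideanSpace ℝ (Fin d) → ℝ)
    (ψ : Fin p → EuclideanSpace ℝ (Fin d) → ℝ)
    (X : Fin T → EuclideanSpace ℝ (Fin d)) : EuclideanSpace ℝ (Fin d) → ℝ :=
  sieveFun ψ (lsCoef (designMatrix ψ X) (fun t => f (X t)))

/-- `Σ_i = E(ε_i ε_i')`. -/
def errCov {n T : ℕ} {Ω : Type*} [MeasurableSpace Ω] (μ : Measure Ω)
    (ε : Fin n → Fin T → Ω → ℝ) (i : Fin n) : Matrix (Fin T) (Fin T) ℝ :=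
  Matrix.of fun t u => ∫ ω, ε i t ω * ε i u ω ∂μ

/-- `Σ̄ = (1/n) ∑ Σ_i`. -/
def avgCov {n T : ℕ} {Ω : Type*} [MeasurableSpace Ω] (μ : Measure Ω)
    (ε : Fin n → Fin T → Ω → ℝ) : Matrix (Fin T) (Fin T) ℝ :=
  (n : ℝ)⁻¹ • ∑ i, errCov μ ε i

/-- `max_{i,t} E |ε_{it}|^q`. -/
def maxMoment {n T : ℕ} {Ω : Type*} [MeasurableSpace Ω] (μ : Measure Ω)
    (ε : Fin n → Fin T → Ω → ℝ) (q : ℝ) : ℝ :=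
  ⨆ i : Fin n × Fin T, ∫ ω, |ε i.1 i.2 ω| ^ q ∂μ

/-- Residuals `Û_i = Y_i - Ψ β̂`. -/
def resid {d n T p : ℕ} {Ω : Type*} (f : EuclideanSpace ℝ (Fin d) → ℝ)
    (ψ : Fin p → EuclideanSpace ℝ (Fin d) → ℝ)
    (X : Fin T → EuclideanSpace ℝ (Fin d)) (ε : Fin n → Fin T → Ω → ℝ)
    (i : Fin n) (ω : Ω) : Fin T → ℝ :=
  obs f X ε i ω - designMatrix ψ X *ᵥ betaHat f ψ X ε ω

/-- The estimator `(1/n) ∑ Û_i Û_i'` of `Σ̄`. -/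
def avgCovHat {d n T p : ℕ} {Ω : Type*} (f : EuclideanSpace ℝ (Fin d) → ℝ)
    (ψ : Fin p → EuclideanSpace ℝ (Fin d) → ℝ)
    (X : Fin T → EuclideanSpace ℝ (Fin d)) (ε : Fin n → Fin T → Ω → ℝ) (ω : Ω) :
    Matrix (Fin T) (Fin T) ℝ :=
  (n : ℝ)⁻¹ • ∑ i, Matrix.vecMulVec (resid f ψ X ε i ω) (resid f ψ X ε i ω)

/-- The variance `(1/n) Ψ̃ (Ψ'Ψ)⁻¹ Ψ' S Ψ (Ψ'Ψ)⁻¹ Ψ̃'`; it is `V_{nT}` for `S = Σ̄`. -/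
def sandwich {T p R : ℕ} (n : ℕ) (Ψ : Matrix (Fin T) (Fin p) ℝ) (Ψt : Matrix (Fin R) (Fin p) ℝ)
    (S : Matrix (Fin T) (Fin T) ℝ) : Matrix (Fin R) (Fin R) ℝ :=
  (n : ℝ)⁻¹ • (Ψt * (Ψᵀ * Ψ)⁻¹ * Ψᵀ * S * Ψ * (Ψᵀ * Ψ)⁻¹ * Ψtᵀ)

/-- The centred statistic `V(S)^{-1/2} (Λ(f̂_P) - E Λ(f̂_P))`, where `V(S)` is the sandwich with
middle matrix `S`. For `S = Σ̄` it is `W̄_{nT}`. -/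
def wBar {d n T p R : ℕ} {Ω : Type*} [MeasurableSpace Ω] (μ : Measure Ω)
    (f : EuclideanSpace ℝ (Fin d) → ℝ) (ψ : Fin p → EuclideanSpace ℝ (Fin d) → ℝ)
    (X : Fin T → EuclideanSpace ℝ (Fin d)) (ε : Fin n → Fin T → Ω → ℝ)
    (Λ : (EuclideanSpace ℝ (Fin d) → ℝ) → EuclideanSpace ℝ (Fin R))
    (Ψt : Matrix (Fin R) (Fin p) ℝ) (S : Matrix (Fin T) (Fin T) ℝ) (ω : Ω) : Fin R → ℝ :=
  invSqrt (sandwich n (designMatrix ψ X) Ψt S) *ᵥ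
    WithLp.ofLp (Λ (fHat f ψ X ε ω) - ∫ ω', Λ (fHat f ψ X ε ω') ∂μ)

/-- `(W̄'W̄ - R) / √(2R)` computed with the matrix `Σ̄`. -/
def stdWald {d n T p R : ℕ} {Ω : Type*} [MeasurableSpace Ω] (μ : Measure Ω)
    (f : EuclideanSpace ℝ (Fin d) → ℝ) (ψ : Fin p → EuclideanSpace ℝ (Fin d) → ℝ)
    (X : Fin T → EuclideanSpace ℝ (Fin d)) (ε : Fin n → Fin T → Ω → ℝ)
    (Λ : (EuclideanSpace ℝ (Fin d) → ℝ) → EuclideanSpace ℝ (Fin R))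
    (Ψt : Matrix (Fin R) (Fin p) ℝ) (ω : Ω) : ℝ :=
  (wBar μ f ψ X ε Λ Ψt (avgCov μ ε) ω ⬝ᵥ wBar μ f ψ X ε Λ Ψt (avgCov μ ε) ω - R) / √(2 * R)

/-- The same statistic with `Σ̄` replaced by its residual-based estimator. -/
def stdWaldHat {d n T p R : ℕ} {Ω : Type*} [MeasurableSpace Ω] (μ : Measure Ω)
    (f : EuclideanSpace ℝ (Fin d) → ℝ) (ψ : Fin p → EuclideanSpace ℝ (Fin d) → ℝ)
    (X : Fin T → EuclideanSpace ℝ (Fin d)) (ε : Fin n → Fin T → Ω → ℝ)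
    (Λ : (EuclideanSpace ℝ (Fin d) → ℝ) → EuclideanSpace ℝ (Fin R))
    (Ψt : Matrix (Fin R) (Fin p) ℝ) (ω : Ω) : ℝ :=
  (wBar μ f ψ X ε Λ Ψt (avgCovHat f ψ X ε ω) ω ⬝ᵥ wBar μ f ψ X ε Λ Ψt (avgCovHat f ψ X ε ω) ω
    - R) / √(2 * R)

/-- Ratio of the extreme eigenvalues of `Ψ̃Ψ̃'`. -/
def condGram {p R : ℕ} (Ψt : Matrix (Fin R) (Fin p) ℝ) : ℝ :=
  lambdaMax (Ψt * Ψtᵀ) / lambdaMin (Ψt * Ψtᵀ)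

/-! ### Assumptions -/

/-- The errors: random vectors with mean zero, finite second moments and positive definite
covariance matrices, uncorrelated across individuals. -/
structure ErrorMoments {n T : ℕ} {Ω : Type*} [MeasurableSpace Ω] (μ : Measure Ω)
    (ε : Fin n → Fin T → Ω → ℝ) : Prop where
  meas : ∀ i t, Measurable (ε i t)
  memLp : ∀ i t, MemLp (ε i t) 2 μ
  mean_zero : ∀ i t, ∫ ω, ε i t ω ∂μ = 0
  uncorrelated : ∀ i i', i ≠ i' → ∀ t u, ∫ ω, ε i t ω * ε i' u ω ∂μ = 0
  cov_posDef : ∀ i, (errCov μ ε i).PosDef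

/-- `Ψ'Ψ/T` approaches, in Frobenius norm, positive definite matrices `Q_P` whose smallest
eigenvalues are bounded away from zero. -/
def DesignConverges {ι : Type*} (l : Filter ι) {d : ℕ} (T P : ι → ℕ)
    (ψ : ∀ p : ℕ, Fin p → EuclideanSpace ℝ (Fin d) → ℝ)
    (X : ∀ k, Fin (T k) → EuclideanSpace ℝ (Fin d)) : Prop :=
  ∃ Q : ∀ p : ℕ, Matrix (Fin p) (Fin p) ℝ,
    (∀ k, (Q (P k)).PosDef) ∧ (∃ c : ℝ, 0 < c ∧ ∀ k, c ≤ lambdaMin (Q (P k))) ∧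
    Tendsto (fun k => frobNorm ((T k : ℝ)⁻¹ •
      ((designMatrix (ψ (P k)) (X k))ᵀ * designMatrix (ψ (P k)) (X k)) - Q (P k))) l (𝓝 0)

/-- For every `s ≥ 0`, `ζ_s(P)` exists, and `ζ_s(P) ≥ 1` for large `P`. -/
def BasisRegular {d : ℕ} (S : Set (EuclideanSpace ℝ (Fin d)))
    (ψ : ∀ p : ℕ, Fin p → EuclideanSpace ℝ (Fin d) → ℝ) : Prop :=
  ∀ s : ℕ, (∀ p j, MemSob S s (ψ p j)) ∧ ∀ᶠ p in atTop, 1 ≤ zeta S s (ψ p)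

/-- Variance and approximation conditions for consistency of the sieve estimator in `|·|_s`. -/
def ConsistencyRates {ι : Type*} (l : Filter ι) {d : ℕ} (S : Set (EuclideanSpace ℝ (Fin d)))
    (s : ℕ) (n T P : ι → ℕ) {Ω : ι → Type*} [∀ k, MeasurableSpace (Ω k)]
    (μ : ∀ k, Measure (Ω k)) (f : EuclideanSpace ℝ (Fin d) → ℝ)
    (ψ : ∀ p : ℕ, Fin p → EuclideanSpace ℝ (Fin d) → ℝ)
    (X : ∀ k, Fin (T k) → EuclideanSpace ℝ (Fin d))
    (ε : ∀ k, Fin (n k) → Fin (T k) → Ω k → ℝ) : Prop :=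
  Tendsto (fun k => zeta S s (ψ (P k)) *
    √(min (P k * lambdaMax (avgCov (μ k) (ε k))) (avgCov (μ k) (ε k)).trace / (n k * T k)))
    l (𝓝 0) ∧
  (s = 0 → Tendsto (fun k => sobNorm S s (f - fZero f (ψ (P k)) (X k))) l (𝓝 0)) ∧
  (0 < s → Tendsto (fun k => zeta S s (ψ (P k)) *
    sobNorm S s (f - fZero f (ψ (P k)) (X k))) l (𝓝 0))

/-- Linearity on `W_{s,∞}`. -/
def LinearOnSob {d R : ℕ} (S : Set (EuclideanSpace ℝ (Fin d))) (s : ℕ)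
    (Λ : (EuclideanSpace ℝ (Fin d) → ℝ) → EuclideanSpace ℝ (Fin R)) : Prop :=
  ∀ g h, MemSob S s g → MemSob S s h → ∀ a b : ℝ, Λ (a • g + b • h) = a • Λ g + b • Λ h

/-- `Λ(ψ_P β) = Ψ̃ β` for all `β`. -/
def RepresentedBy {d p R : ℕ} (ψ : Fin p → EuclideanSpace ℝ (Fin d) → ℝ)
    (Λ : (EuclideanSpace ℝ (Fin d) → ℝ) → EuclideanSpace ℝ (Fin R))
    (Ψt : Matrix (Fin R) (Fin p) ℝ) : Prop :=
  ∀ β : Fin p → ℝ, Λ (sieveFun ψ β) = WithLp.toLp 2 (Ψt *ᵥ β)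

/-- `‖Λ(g)‖ ≤ C |g|_s` on `W_{s,∞}`, for some finite constant `C > 0`. -/
def BoundedOnSob {d R : ℕ} (S : Set (EuclideanSpace ℝ (Fin d))) (s : ℕ)
    (Λ : (EuclideanSpace ℝ (Fin d) → ℝ) → EuclideanSpace ℝ (Fin R)) : Prop :=
  ∃ C : ℝ, 0 < C ∧ ∀ g, MemSob S s g → ‖Λ g‖ ≤ C * sobNorm S s g

/-- `Γ` is a bounded linear functional whose restriction to the sieve space is given by `Ψ̃`. -/
structure LinearFunctional {d p R : ℕ} (S : Set (EuclideanSpace ℝ (Fin d))) (s : ℕ)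
    (ψ : Fin p → EuclideanSpace ℝ (Fin d) → ℝ)
    (Γ : (EuclideanSpace ℝ (Fin d) → ℝ) → EuclideanSpace ℝ (Fin R))
    (Ψt : Matrix (Fin R) (Fin p) ℝ) : Prop where
  linear : LinearOnSob S s Γ
  bounded : BoundedOnSob S s Γ
  represented : RepresentedBy ψ Γ Ψt

/-- `Γ` is a (nonlinear) functional with directional derivative `Γ' (g; h) = DΓ g h`, linear in
`g`, with the quadratic remainder, Lipschitz and boundedness properties near the function `f`;
the restriction of `Γ'(·; f)` to the sieve space is given by `Ψ̃`. -/
structure NonlinearFunctional {d p R : ℕ} (S : Set (EuclideanSpace ℝ (Fin d))) (s : ℕ)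
    (f : EuclideanSpace ℝ (Fin d) → ℝ) (ψ : Fin p → EuclideanSpace ℝ (Fin d) → ℝ)
    (Γ : (EuclideanSpace ℝ (Fin d) → ℝ) → EuclideanSpace ℝ (Fin R))
    (DΓ : (EuclideanSpace ℝ (Fin d) → ℝ) → (EuclideanSpace ℝ (Fin d) → ℝ) →
      EuclideanSpace ℝ (Fin R))
    (Ψt : Matrix (Fin R) (Fin p) ℝ) : Prop where
  linear : ∀ h, MemSob S s h → LinearOnSob S s (fun g => DΓ g h)
  represented : RepresentedBy ψ (fun g => DΓ g f) Ψt
  smooth : ∃ C₄ C₅ r : ℝ, 0 < C₄ ∧ 0 < C₅ ∧ 0 < r ∧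
    ∀ g h, MemSob S s g → MemSob S s h → sobNorm S s (f - g) < r → sobNorm S s (f - h) < r →
      ‖Γ f - Γ g - DΓ (f - g) g‖ ≤ C₄ * sobNorm S s (f - g) ^ 2 ∧
      ‖DΓ f g - DΓ f h‖ ≤ C₅ * sobNorm S s f * sobNorm S s (g - h)
  bounded : BoundedOnSob S s (fun g => DΓ g f)

/-- `λ_min(Σ̄) > 0`, and the Lyapunov-type moment condition with exponent `2 + δ`. -/
def LyapunovCondition {ι : Type*} (l : Filter ι) (n T : ι → ℕ) {Ω : ι → Type*}
    [∀ k, MeasurableSpace (Ω k)] (μ : ∀ k, Measure (Ω k))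
    (ε : ∀ k, Fin (n k) → Fin (T k) → Ω k → ℝ) : Prop :=
  (∀ k, 0 < lambdaMin (avgCov (μ k) (ε k))) ∧
  ∃ δ : ℝ, 0 < δ ∧
    (∀ᶠ k in l, ∀ i t, MemLp (ε k i t) (ENNReal.ofReal (2 + δ)) (μ k)) ∧
    Tendsto (fun k => (T k : ℝ) ^ (1 + δ / 2) * maxMoment (μ k) (ε k) (2 + δ) /
      ((n k : ℝ) ^ (δ / 2) * lambdaMin (avgCov (μ k) (ε k)) ^ (1 + δ / 2))) l (𝓝 0)

end

/-! ### Extreme eigenvalues -/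

/-! Everything is measured in the coordinates in which the true variance is the identity. With A =
Ψ̃(Ψ'Ψ)⁻¹Ψ' and V = V(Σ̄), the matrix B = (nV)^{-1/2}A (`stdMatrix`) satisfies B Σ̄ B' = 1. The
functional acts on the sieve through Ψ̃, so centring removes f and the statistic is exactly the
score w = n^{-1/2} ∑ B ε_i (`wBar_avgCov`). Also AΨβ̂ = AȲ, so B maps the residual Û_i to B(ε_i -
ε̄), with ε̄ the mean error, and no approximation error survives. Hence V^{-1/2} V̂ V^{-1/2} - 1 = D
- ww'/n, where V̂ is the sandwich with the estimated covariance and D (`covError`) is the sampling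
error of the second moments of the B ε_i (`standardized_avgCovHat`).

If this difference has norm at most δ ≤ 1/2, the Wald form |w|² moves by at most 2δ|w|²
(`abs_wald_sub_le`). It remains to bound δ and |w|². The score satisfies E|w|² = R. Since ‖B‖² ≤
1/λ_min(Σ̄), independence and fourth moments give E‖D‖_F² ≤ ρ² with ρ = T√m₄/(√n λ_min(Σ̄)) and m₄
the largest fourth moment (`integral_frobNorm_covError_sq_le`). The rank-one term is of the same
order, because R/√n ≤ ρ (`card_le_of_standardized`). Markov's inequality then yields an error of
order ρR/√R = ρ√R. The condition number and the factor 1 ∨ ln R are at least 1, so the stated rate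
follows. -/

theorem lambdaMin_le_lambdaMax {m : ℕ} (hm : 0 < m) {A : Matrix (Fin m) (Fin m) ℝ}
    (hA : A.IsHermitian) : lambdaMin A ≤ lambdaMax A := by
  have hne : (spectrum ℝ A).Nonempty := by
    rw [hA.spectrum_real_eq_range_eigenvalues]
    exact ⟨_, ⟨⟨0, hm⟩, rfl⟩⟩
  have hfin : (spectrum ℝ A).Finite := Matrix.finite_spectrum A
  exact csInf_le_csSup hne hfin.bddBelow hfin.bddAbove

theorem lambdaMin_mul_dotProduct_le {m : ℕ} {A : Matrix (Fin m) (Fin m) ℝ}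
    (hA : A.IsHermitian) (x : Fin m → ℝ) : lambdaMin A * (x ⬝ᵥ x) ≤ x ⬝ᵥ A *ᵥ x := by
  -- Subtracting a scalar matrix translates the spectrum, so the shifted matrix has only nonnegative
  -- eigenvalues.
  have hpsd : (A - algebraMap ℝ _ (lambdaMin A)).PosSemidef := by
    rw [posSemidef_iff_isHermitian_and_spectrum_nonneg]
    refine ⟨hA.sub ?_, ?_⟩
    · rw [Algebra.algebraMap_eq_smul_one]
      simp [Matrix.IsHermitian]
    · rw [← spectrum.sub_singleton_eq]
      rintro _ ⟨a, ha, b, rfl, rfl⟩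
      exact sub_nonneg.2 (csInf_le (Matrix.finite_spectrum A).bddBelow ha)
  have h := hpsd.dotProduct_mulVec_nonneg x
  simp only [star_trivial, Algebra.algebraMap_eq_smul_one, sub_mulVec, smul_mulVec, one_mulVec,
    dotProduct_sub, dotProduct_smul, smul_eq_mul] at h
  linarith

theorem dotProduct_self_pos {m : ℕ} {x : Fin m → ℝ} (hx : x ≠ 0) : 0 < x ⬝ᵥ x := by
  simpa using dotProduct_star_self_pos_iff.2 hx

theorem dotProduct_self_nonneg_real {m : ℕ} (x : Fin m → ℝ) : 0 ≤ x ⬝ᵥ x := by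
  simpa using dotProduct_star_self_nonneg x

theorem posDef_of_lambdaMin_pos {m : ℕ} {A : Matrix (Fin m) (Fin m) ℝ}
    (hA : A.IsHermitian) (h : 0 < lambdaMin A) : A.PosDef := by
  refine PosDef.of_dotProduct_mulVec_pos hA fun x hx => ?_
  rw [star_trivial]
  exact (mul_pos h (dotProduct_self_pos hx)).trans_le (lambdaMin_mul_dotProduct_le hA x)

/-- The spectrum is finite and nonempty, so the infimum is an actual eigenvalue. Dimension zero must
be excluded because `sInf ∅ = 0`. -/
theorem lambdaMin_pos {m : ℕ} (hm : 0 < m) {A : Matrix (Fin m) (Fin m) ℝ}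
    (hA : A.PosDef) : 0 < lambdaMin A := by
  have hne : (spectrum ℝ A).Nonempty := by
    rw [hA.1.spectrum_real_eq_range_eigenvalues]
    exact ⟨_, ⟨⟨0, hm⟩, rfl⟩⟩
  have hmem := hne.csInf_mem (Matrix.finite_spectrum A)
  rw [hA.1.spectrum_real_eq_range_eigenvalues] at hmem
  obtain ⟨i, hi⟩ := hmem
  rw [lambdaMin, hA.1.spectrum_real_eq_range_eigenvalues, ← hi]
  exact hA.eigenvalues_pos i

theorem isHermitian_mul_transpose {m p : ℕ} (A : Matrix (Fin m) (Fin p) ℝ) :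
    (A * Aᵀ).IsHermitian := by
  simpa using isHermitian_mul_conjTranspose_self A

theorem one_le_condGram {p R : ℕ} (hR : 0 < R) {Ψt : Matrix (Fin R) (Fin p) ℝ}
    (h : 0 < lambdaMin (Ψt * Ψtᵀ)) : 1 ≤ condGram Ψt :=
  (one_le_div h).2 (lambdaMin_le_lambdaMax hR (isHermitian_mul_transpose Ψt))

/-! ### The inverse square root -/

theorem invSqrt_transpose {m : ℕ} (V : Matrix (Fin m) (Fin m) ℝ) : (invSqrt V)ᵀ = invSqrt V := by
  have h : IsSelfAdjoint (invSqrt V) := cfc_predicate _ _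
  simpa [star_eq_conjTranspose] using h.star_eq

/-- On a finite spectrum every function is continuous, so the identity reduces to (√x)⁻¹(√x)⁻¹x = 1.
This needs x > 0, since (√x)⁻¹ takes the default value 0 elsewhere. -/
theorem invSqrt_mul_self {m : ℕ} {V : Matrix (Fin m) (Fin m) ℝ} (hV : V.PosDef) :
    invSqrt V * invSqrt V = V⁻¹ := by
  have hsa : IsSelfAdjoint V := hV.1
  have hpos : ∀ x ∈ spectrum ℝ V, 0 < x := by
    intro x hx
    rw [hV.1.spectrum_real_eq_range_eigenvalues] at hx
    obtain ⟨i, rfl⟩ := hx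
    exact hV.eigenvalues_pos i
  have hc : ∀ g : ℝ → ℝ, ContinuousOn g (spectrum ℝ V) :=
    fun g => (Matrix.finite_spectrum V).continuousOn g
  refine (Matrix.inv_eq_left_inv ?_).symm
  unfold invSqrt
  rw [← cfc_mul _ _ V (hc _) (hc _)]
  nth_rewrite 2 [← cfc_id' ℝ V]
  rw [← cfc_mul _ _ V (hc _) (hc _), ← cfc_one ℝ V]
  refine cfc_congr fun x hx => ?_
  have := hpos x hx
  simp only [Pi.one_apply]
  rw [← mul_inv, Real.mul_self_sqrt this.le, inv_mul_cancel₀ this.ne']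

theorem invSqrt_mul_mul_invSqrt {m : ℕ} {V : Matrix (Fin m) (Fin m) ℝ} (hV : V.PosDef) :
    invSqrt V * V * invSqrt V = 1 := by
  have h : invSqrt V * (invSqrt V * V) = 1 := by
    rw [← Matrix.mul_assoc, invSqrt_mul_self hV]
    exact nonsing_inv_mul V (hV.isUnit.map detMonoidHom)
  exact mul_eq_one_comm.1 h

theorem invSqrt_mulVec_dotProduct_self {m : ℕ} {V : Matrix (Fin m) (Fin m) ℝ} (hV : V.PosDef)
    (z : Fin m → ℝ) : invSqrt V *ᵥ z ⬝ᵥ invSqrt V *ᵥ z = z ⬝ᵥ V⁻¹ *ᵥ z := by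
  rw [← invSqrt_mul_self hV, ← mulVec_mulVec, dotProduct_mulVec z, ← mulVec_transpose,
    invSqrt_transpose]

/-! ### Bilinear bounds -/

theorem sq_dotProduct_le {m : ℕ} (x y : Fin m → ℝ) : (x ⬝ᵥ y) ^ 2 ≤ (x ⬝ᵥ x) * (y ⬝ᵥ y) := by
  simpa [dotProduct, ← sq] using Finset.sum_mul_sq_le_sq_mul_sq Finset.univ x y

theorem abs_dotProduct_le {m : ℕ} (x y : Fin m → ℝ) :
    |x ⬝ᵥ y| ≤ √(x ⬝ᵥ x) * √(y ⬝ᵥ y) := by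
  rw [← Real.sqrt_mul (dotProduct_self_nonneg_real x)]
  exact Real.abs_le_sqrt (sq_dotProduct_le x y)

theorem abs_dotProduct_mulVec_le {m p : ℕ} (D : Matrix (Fin m) (Fin p) ℝ) (x : Fin m → ℝ)
    (y : Fin p → ℝ) : |x ⬝ᵥ D *ᵥ y| ≤ frobNorm D * (√(x ⬝ᵥ x) * √(y ⬝ᵥ y)) := by
  have hD : 0 ≤ ∑ i, ∑ j, D i j ^ 2 :=
    Finset.sum_nonneg fun i _ => Finset.sum_nonneg fun j _ => sq_nonneg _
  have h1 : D *ᵥ y ⬝ᵥ D *ᵥ y ≤ (∑ i, ∑ j, D i j ^ 2) * (y ⬝ᵥ y) := by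
    rw [Finset.sum_mul, dotProduct]
    refine Finset.sum_le_sum fun i _ => ?_
    have h := sq_dotProduct_le (D i) y
    simp only [dotProduct, ← sq] at h ⊢
    exact h
  calc |x ⬝ᵥ D *ᵥ y| ≤ √(x ⬝ᵥ x) * √(D *ᵥ y ⬝ᵥ D *ᵥ y) := abs_dotProduct_le _ _
    _ ≤ √(x ⬝ᵥ x) * √((∑ i, ∑ j, D i j ^ 2) * (y ⬝ᵥ y)) := by gcongr
    _ = frobNorm D * (√(x ⬝ᵥ x) * √(y ⬝ᵥ y)) := by
      rw [Real.sqrt_mul hD, frobNorm]; ring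

/-- If `B Σ B' = 1`, then `B` has operator norm at most `λ_min(Σ)^{-1/2}`. -/
theorem lambdaMin_mul_mulVec_dotProduct_le {R T : ℕ} {A : Matrix (Fin T) (Fin T) ℝ}
    {B : Matrix (Fin R) (Fin T) ℝ} (hA : A.IsHermitian) (hB : B * A * Bᵀ = 1)
    (hpos : 0 < lambdaMin A) (x : Fin T → ℝ) :
    lambdaMin A * (B *ᵥ x ⬝ᵥ B *ᵥ x) ≤ x ⬝ᵥ x := by
  set y := B *ᵥ x with hy
  -- The bound is first proved for the adjoint: y'BAB'y = |y|² and A ≥ λ_min(A). Writing |y|² =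
  -- ⟨B'y, x⟩ and applying Cauchy–Schwarz transfers it to B.
  have h1 : lambdaMin A * (Bᵀ *ᵥ y ⬝ᵥ Bᵀ *ᵥ y) ≤ y ⬝ᵥ y := by
    refine (lambdaMin_mul_dotProduct_le hA _).trans_eq ?_
    rw [mulVec_transpose B y, ← dotProduct_mulVec, ← mulVec_transpose, mulVec_mulVec,
      mulVec_mulVec, hB, one_mulVec]
  have h2 : y ⬝ᵥ y = Bᵀ *ᵥ y ⬝ᵥ x := by
    rw [mulVec_transpose, ← dotProduct_mulVec]
  have h3 := sq_dotProduct_le (Bᵀ *ᵥ y) x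
  rw [← h2] at h3
  rcases (dotProduct_self_nonneg_real y).eq_or_lt with h0 | h0
  · rw [← h0, mul_zero]; exact dotProduct_self_nonneg_real x
  · refine le_of_mul_le_mul_left ?_ h0
    calc (y ⬝ᵥ y) * (lambdaMin A * (y ⬝ᵥ y)) = lambdaMin A * (y ⬝ᵥ y) ^ 2 := by ring
      _ ≤ lambdaMin A * ((Bᵀ *ᵥ y ⬝ᵥ Bᵀ *ᵥ y) * (x ⬝ᵥ x)) := by gcongr
      _ = lambdaMin A * (Bᵀ *ᵥ y ⬝ᵥ Bᵀ *ᵥ y) * (x ⬝ᵥ x) := by ring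
      _ ≤ (y ⬝ᵥ y) * (x ⬝ᵥ x) :=
        mul_le_mul_of_nonneg_right h1 (dotProduct_self_nonneg_real x)

/-- Perturbation of a Wald form: if `V^{-1/2} V̂ V^{-1/2} - 1` has norm at most `δ ≤ 1/2`, then
replacing `V` by `V̂` changes `z' V⁻¹ z` by a relative error of at most `2 δ`. -/
theorem abs_wald_sub_le {R : ℕ} {V V' : Matrix (Fin R) (Fin R) ℝ} (hV : V.PosDef)
    (hV' : V'.IsHermitian) {δ : ℝ} (hδ : δ ≤ 1 / 2)
    (hD : ∀ x y : Fin R → ℝ, |x ⬝ᵥ (invSqrt V * V' * invSqrt V - 1) *ᵥ y| ≤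
      δ * (√(x ⬝ᵥ x) * √(y ⬝ᵥ y))) (z : Fin R → ℝ) :
    |invSqrt V' *ᵥ z ⬝ᵥ invSqrt V' *ᵥ z - invSqrt V *ᵥ z ⬝ᵥ invSqrt V *ᵥ z| ≤
      2 * δ * (invSqrt V *ᵥ z ⬝ᵥ invSqrt V *ᵥ z) := by
  set S := invSqrt V with hS
  have hSt : Sᵀ = S := invSqrt_transpose V
  have hSVS : S * V * S = 1 := invSqrt_mul_mul_invSqrt hV
  have hS1 : S * (V * S) = 1 := by rw [← Matrix.mul_assoc, hSVS]
  have hsymm : ∀ u v : Fin R → ℝ, S *ᵥ u ⬝ᵥ v = u ⬝ᵥ S *ᵥ v := fun u v => by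
    rw [dotProduct_mulVec, ← mulVec_transpose, hSt]
  set D := S * V' * S - 1 with hDdef
  have hSV'S : S * V' * S = 1 + D := by rw [hDdef]; abel
  -- Invertibility of `V'` is not assumed: in the coordinate x = V^{1/2}u its form is |x|² + x'Dx ≥
  -- (1 - δ)|x|² > 0.
  have hpd' : V'.PosDef := by
    refine PosDef.of_dotProduct_mulVec_pos hV' fun u hu => ?_
    rw [star_trivial]
    set x := (V * S) *ᵥ u with hx
    have hux : u = S *ᵥ x := by rw [hx, mulVec_mulVec, hS1, one_mulVec]
    have hx0 : x ≠ 0 := by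
      intro h; exact hu (by rw [hux, h, mulVec_zero])
    have h1 : u ⬝ᵥ V' *ᵥ u = x ⬝ᵥ x + x ⬝ᵥ D *ᵥ x := by
      rw [hux, hsymm, mulVec_mulVec, mulVec_mulVec, hSV'S, add_mulVec,
        one_mulVec, dotProduct_add]
    have h2 := hD x x
    rw [Real.mul_self_sqrt (dotProduct_self_nonneg_real x)] at h2
    have h3 := dotProduct_self_pos hx0
    have h4 := neg_le_of_abs_le h2
    rw [h1]
    nlinarith
  rw [invSqrt_mulVec_dotProduct_self hpd']
  set w := S *ᵥ z with hw
  -- `x = V^{1/2} V̂⁻¹ z` solves `(1 + D) x = w`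
  set x := (V * S) *ᵥ (V'⁻¹ *ᵥ z) with hx
  have hSx : S *ᵥ x = V'⁻¹ *ᵥ z := by rw [hx, mulVec_mulVec, hS1, one_mulVec]
  have hwx : w = x + D *ᵥ x := by
    have : (1 + D) *ᵥ x = w := by
      rw [← hSV'S, ← mulVec_mulVec, hSx, mulVec_mulVec, Matrix.mul_assoc,
        mul_nonsing_inv V' (hpd'.isUnit.map detMonoidHom), Matrix.mul_one]
    rw [← this, add_mulVec, one_mulVec]
  have hz : z ⬝ᵥ V'⁻¹ *ᵥ z = w ⬝ᵥ x := by rw [← hSx, hw, hsymm]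
  have hx0 := dotProduct_self_nonneg_real x
  have hw0 := dotProduct_self_nonneg_real w
  -- Since |x|² = x'w - x'Dx ≤ |x||w| + δ|x|², the bound δ ≤ 1/2 absorbs the last term into the left
  -- side.
  have hxw : √(x ⬝ᵥ x) ≤ 2 * √(w ⬝ᵥ w) := by
    have h1 : x ⬝ᵥ x = x ⬝ᵥ w - x ⬝ᵥ D *ᵥ x := by
      conv_rhs => rw [hwx]
      rw [dotProduct_add]; ring
    have h2 := neg_le_of_abs_le (hD x x)
    have h3 := (le_abs_self _).trans (abs_dotProduct_le x w)
    have h4 := Real.mul_self_sqrt hx0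
    by_contra! hcon
    have h5 : 0 < √(x ⬝ᵥ x) := (mul_nonneg two_pos.le (Real.sqrt_nonneg _)).trans_lt hcon
    nlinarith
  have hdiff : w ⬝ᵥ x - w ⬝ᵥ w = -(w ⬝ᵥ D *ᵥ x) := by
    nth_rewrite 3 [hwx]
    rw [dotProduct_add]; ring
  rw [hz, hdiff, abs_neg]
  refine (hD w x).trans ?_
  -- No sign of δ is assumed; a negative δ in `hD` forces w = 0.
  rcases lt_or_ge δ 0 with hneg | hδ0
  · have h1 := (abs_nonneg _).trans (hD w w)
    rw [Real.mul_self_sqrt hw0] at h1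
    have hw' : w ⬝ᵥ w = 0 := by nlinarith
    simp [hw']
  · calc δ * (√(w ⬝ᵥ w) * √(x ⬝ᵥ x)) ≤ δ * (√(w ⬝ᵥ w) * (2 * √(w ⬝ᵥ w))) := by gcongr
      _ = 2 * δ * (√(w ⬝ᵥ w) * √(w ⬝ᵥ w)) := by ring
      _ = 2 * δ * (w ⬝ᵥ w) := by rw [Real.mul_self_sqrt hw0]

/-! ### The design matrix -/

/-- The Frobenius norm dominates the operator norm, so x'(Ψ'Ψ/T)x is at least λ_min(Q)|x|² minus the
perturbation, which is positive. -/
theorem posDef_gram_of_frobNorm_lt {T p : ℕ} (Ψ : Matrix (Fin T) (Fin p) ℝ)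
    {Q : Matrix (Fin p) (Fin p) ℝ} (hQ : Q.IsHermitian)
    (h : frobNorm ((T : ℝ)⁻¹ • (Ψᵀ * Ψ) - Q) < lambdaMin Q) : (Ψᵀ * Ψ).PosDef := by
  refine PosDef.of_dotProduct_mulVec_pos (by simpa using isHermitian_conjTranspose_mul_self Ψ)
    fun x hx => ?_
  rw [star_trivial]
  have h1 := neg_le_of_abs_le (abs_dotProduct_mulVec_le ((T : ℝ)⁻¹ • (Ψᵀ * Ψ) - Q) x x)
  rw [Real.mul_self_sqrt (dotProduct_self_nonneg_real x), sub_mulVec, dotProduct_sub, smul_mulVec,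
    dotProduct_smul, smul_eq_mul] at h1
  have h2 := lambdaMin_mul_dotProduct_le hQ x
  have h3 := dotProduct_self_pos hx
  have h4 : 0 < (T : ℝ)⁻¹ * (x ⬝ᵥ (Ψᵀ * Ψ) *ᵥ x) := by nlinarith
  exact pos_of_mul_pos_right h4 (by positivity)

/-- The matrix `Ψ̃ (Ψ'Ψ)⁻¹ Ψ'` mapping observations to the estimated functional. -/
noncomputable def estMatrix {T p R : ℕ} (Ψ : Matrix (Fin T) (Fin p) ℝ) (Ψt : Matrix (Fin R) (Fin p) ℝ) :
    Matrix (Fin R) (Fin T) ℝ := Ψt * (Ψᵀ * Ψ)⁻¹ * Ψᵀ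

theorem mulVec_lsCoef {T p R : ℕ} (Ψ : Matrix (Fin T) (Fin p) ℝ) (Ψt : Matrix (Fin R) (Fin p) ℝ)
    (y : Fin T → ℝ) : Ψt *ᵥ lsCoef Ψ y = estMatrix Ψ Ψt *ᵥ y := by
  simp [lsCoef, estMatrix, mulVec_mulVec, Matrix.mul_assoc]

theorem estMatrix_transpose {T p R : ℕ} (Ψ : Matrix (Fin T) (Fin p) ℝ)
    (Ψt : Matrix (Fin R) (Fin p) ℝ) : (estMatrix Ψ Ψt)ᵀ = Ψ * (Ψᵀ * Ψ)⁻¹ * Ψtᵀ := by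
  simp [estMatrix, transpose_mul, transpose_nonsing_inv, Matrix.mul_assoc]

theorem sandwich_eq {T p R : ℕ} (n : ℕ) (Ψ : Matrix (Fin T) (Fin p) ℝ)
    (Ψt : Matrix (Fin R) (Fin p) ℝ) (M : Matrix (Fin T) (Fin T) ℝ) :
    sandwich n Ψ Ψt M = (n : ℝ)⁻¹ • (estMatrix Ψ Ψt * M * (estMatrix Ψ Ψt)ᵀ) := by
  rw [estMatrix_transpose, sandwich, estMatrix]
  simp only [Matrix.mul_assoc]

theorem sandwich_isHermitian {T p R : ℕ} (n : ℕ) (Ψ : Matrix (Fin T) (Fin p) ℝ)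
    (Ψt : Matrix (Fin R) (Fin p) ℝ) {M : Matrix (Fin T) (Fin T) ℝ} (hM : M.IsHermitian) :
    (sandwich n Ψ Ψt M).IsHermitian := by
  have hM' : Mᵀ = M := by simpa using hM.eq
  rw [sandwich_eq, IsHermitian, conjTranspose_eq_transpose_of_trivial]
  simp [transpose_mul, hM', Matrix.mul_assoc]

theorem estMatrix_mul_design_mulVec_lsCoef {T p R : ℕ} {Ψ : Matrix (Fin T) (Fin p) ℝ}
    (hG : (Ψᵀ * Ψ).PosDef) (Ψt : Matrix (Fin R) (Fin p) ℝ) (y : Fin T → ℝ) :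
    estMatrix Ψ Ψt *ᵥ (Ψ *ᵥ lsCoef Ψ y) = estMatrix Ψ Ψt *ᵥ y := by
  rw [← mulVec_lsCoef Ψ Ψt y, mulVec_mulVec, estMatrix, Matrix.mul_assoc, Matrix.mul_assoc,
    nonsing_inv_mul _ (hG.isUnit.map detMonoidHom), Matrix.mul_one]

/-- Positivity of `M` passes through the sandwich because the transpose of `estMatrix` is injective:
composed with Ψ' it gives Ψ̃', which is injective as Ψ̃Ψ̃' is positive definite. -/
theorem sandwich_posDef {T p R n : ℕ} (hn : 0 < n) {Ψ : Matrix (Fin T) (Fin p) ℝ}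
    (hG : (Ψᵀ * Ψ).PosDef) {Ψt : Matrix (Fin R) (Fin p) ℝ} (hΨt : (Ψt * Ψtᵀ).PosDef)
    {M : Matrix (Fin T) (Fin T) ℝ} (hM : M.PosDef) : (sandwich n Ψ Ψt M).PosDef := by
  refine PosDef.of_dotProduct_mulVec_pos (sandwich_isHermitian n Ψ Ψt hM.1) fun x hx => ?_
  have hdot : ∀ {k l : ℕ} (C : Matrix (Fin k) (Fin l) ℝ) (u : Fin k → ℝ) (v : Fin l → ℝ),
      u ⬝ᵥ C *ᵥ v = Cᵀ *ᵥ u ⬝ᵥ v := fun C u v => by rw [dotProduct_mulVec, mulVec_transpose]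
  have h1 : Ψtᵀ *ᵥ x ≠ 0 := by
    intro h0
    have := hΨt.dotProduct_mulVec_pos hx
    rw [star_trivial, ← mulVec_mulVec, h0] at this
    simp at this
  have h2 : (estMatrix Ψ Ψt)ᵀ *ᵥ x ≠ 0 := by
    intro h0
    have h3 : Ψᵀ *ᵥ ((estMatrix Ψ Ψt)ᵀ *ᵥ x) = Ψtᵀ *ᵥ x := by
      rw [mulVec_mulVec, estMatrix_transpose, ← Matrix.mul_assoc, ← Matrix.mul_assoc,
        mul_nonsing_inv _ (hG.isUnit.map detMonoidHom), Matrix.one_mul]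
    exact h1 (by rw [← h3, h0, mulVec_zero])
  have h4 := hM.dotProduct_mulVec_pos h2
  rw [star_trivial] at h4 ⊢
  rw [sandwich_eq, smul_mulVec, dotProduct_smul, ← mulVec_mulVec, ← mulVec_mulVec, hdot,
    smul_eq_mul]
  positivity

/-! ### Moments of linear images of the errors -/

theorem memLp_mulVec {Ω : Type*} [MeasurableSpace Ω] {μ : Measure Ω} {R T : ℕ}
    (B : Matrix (Fin R) (Fin T) ℝ) {e : Fin T → Ω → ℝ} {q : ENNReal}
    (he : ∀ t, MemLp (e t) q μ) (j : Fin R) :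
    MemLp (fun ω => (B *ᵥ fun t => e t ω) j) q μ := by
  simp only [mulVec, dotProduct]
  exact memLp_finsetSum _ fun t _ => (he t).const_mul (B j t)

theorem memLp_two_mul {Ω : Type*} [MeasurableSpace Ω] {μ : Measure Ω} {X Y : Ω → ℝ}
    (hX : MemLp X 4 μ) (hY : MemLp Y 4 μ) : MemLp (fun ω => X ω * Y ω) 2 μ := by
  have : ENNReal.HolderTriple 4 4 2 := ⟨by
    rw [← two_mul, show (4 : ENNReal) = 2 * 2 by norm_num,
      ENNReal.mul_inv (by simp) (by simp), ← mul_assoc, ENNReal.mul_inv_cancel (by simp) (by simp),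
      one_mul]⟩
  exact hY.mul' hX

theorem integral_mulVec_mul_mulVec {Ω : Type*} [MeasurableSpace Ω] {μ : Measure Ω} {R T : ℕ}
    (B : Matrix (Fin R) (Fin T) ℝ) {e e' : Fin T → Ω → ℝ}
    (he : ∀ t, MemLp (e t) 2 μ) (he' : ∀ t, MemLp (e' t) 2 μ) (j k : Fin R) :
    ∫ ω, (B *ᵥ fun t => e t ω) j * (B *ᵥ fun t => e' t ω) k ∂μ =
      (B * Matrix.of (fun t u => ∫ ω, e t ω * e' u ω ∂μ) * Bᵀ) j k := by
  have hint : ∀ t u, Integrable (fun ω => (B j t * e t ω) * (B k u * e' u ω)) μ := fun t u =>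
    ((he t).const_mul _).integrable_mul ((he' u).const_mul _)
  simp only [mulVec, dotProduct, Finset.sum_mul_sum]
  rw [integral_finsetSum _ fun t _ => integrable_finsetSum _ fun u _ => hint t u]
  simp only [Matrix.mul_apply, transpose_apply, Matrix.of_apply, Finset.sum_mul]
  rw [Finset.sum_comm]
  refine Finset.sum_congr rfl fun t _ => ?_
  rw [integral_finsetSum _ fun u _ => hint t u]
  refine Finset.sum_congr rfl fun u _ => ?_
  rw [← integral_const_mul, ← integral_mul_const]
  exact integral_congr_ae (.of_forall fun ω => by ring)

section Errors

variable {n T R : ℕ} {Ω : Type*} [MeasurableSpace Ω] {μ : Measure Ω}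
  {ε : Fin n → Fin T → Ω → ℝ} {B : Matrix (Fin R) (Fin T) ℝ}

/-! ### Second moments of the standardized errors -/

theorem avgCov_isHermitian (μ : Measure Ω) (ε : Fin n → Fin T → Ω → ℝ) :
    (avgCov μ ε).IsHermitian := by
  ext t u
  simp [avgCov, errCov, Matrix.sum_apply, mul_comm]

theorem avgCov_posDef (hn : 0 < n) (hε : ErrorMoments μ ε) : (avgCov μ ε).PosDef := by
  have hsum : (∑ i, errCov μ ε i).PosDef := by
    have : Nonempty (Fin n) := ⟨⟨0, hn⟩⟩
    exact Matrix.posDef_sum Finset.univ_nonempty fun i _ => hε.cov_posDef i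
  exact hsum.smul (by positivity)

theorem avg_integral_mulVec_mul (hε : ErrorMoments μ ε) (hB : B * avgCov μ ε * Bᵀ = 1)
    (j k : Fin R) :
    (n : ℝ)⁻¹ * ∑ i, ∫ ω, (B *ᵥ fun t => ε i t ω) j * (B *ᵥ fun t => ε i t ω) k ∂μ =
      (1 : Matrix (Fin R) (Fin R) ℝ) j k := by
  rw [← hB, avgCov, Matrix.mul_smul, Matrix.smul_mul, Matrix.mul_sum, Matrix.sum_mul,
    Matrix.smul_apply, Matrix.sum_apply, smul_eq_mul]
  congr 1
  exact Finset.sum_congr rfl fun i _ => integral_mulVec_mul_mulVec B (hε.memLp i) (hε.memLp i) j k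

theorem avg_integral_normSq_mulVec (hε : ErrorMoments μ ε) (hB : B * avgCov μ ε * Bᵀ = 1) :
    (n : ℝ)⁻¹ * ∑ i, ∫ ω, (B *ᵥ fun t => ε i t ω) ⬝ᵥ (B *ᵥ fun t => ε i t ω) ∂μ = R := by
  have hint : ∀ i (j : Fin R), Integrable
      (fun ω => (B *ᵥ fun t => ε i t ω) j * (B *ᵥ fun t => ε i t ω) j) μ := fun i j =>
    (memLp_mulVec B (hε.memLp i) j).integrable_mul (memLp_mulVec B (hε.memLp i) j)
  simp only [dotProduct]
  have : ∀ i, ∫ ω, ∑ j, (B *ᵥ fun t => ε i t ω) j * (B *ᵥ fun t => ε i t ω) j ∂μ =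
      ∑ j, ∫ ω, (B *ᵥ fun t => ε i t ω) j * (B *ᵥ fun t => ε i t ω) j ∂μ := fun i =>
    integral_finsetSum _ fun j _ => hint i j
  simp only [this]
  rw [Finset.sum_comm, Finset.mul_sum]
  simp only [avg_integral_mulVec_mul hε hB, Matrix.one_apply_eq]
  simp

/-- The standardized score `n^{-1/2} B ∑ ε_i`. -/
noncomputable def score (B : Matrix (Fin R) (Fin T) ℝ) (ε : Fin n → Fin T → Ω → ℝ) (ω : Ω) :
    Fin R → ℝ := (√n)⁻¹ • ∑ i, B *ᵥ fun t => ε i t ω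

theorem score_memLp (hε : ErrorMoments μ ε) (j : Fin R) :
    MemLp (fun ω => score B ε ω j) 2 μ := by
  simp only [score, Pi.smul_apply, Finset.sum_apply, smul_eq_mul]
  exact (memLp_finsetSum _ fun i _ => memLp_mulVec B (hε.memLp i) j).const_mul _

theorem integrable_normSq_score (hε : ErrorMoments μ ε) :
    Integrable (fun ω => score B ε ω ⬝ᵥ score B ε ω) μ :=
  integrable_finsetSum _ fun j _ => (score_memLp hε j).integrable_mul (score_memLp hε j)

theorem integral_normSq_score (hε : ErrorMoments μ ε) (hB : B * avgCov μ ε * Bᵀ = 1) :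
    ∫ ω, score B ε ω ⬝ᵥ score B ε ω ∂μ = R := by
  have hint : ∀ i i' (j : Fin R), Integrable
      (fun ω => (B *ᵥ fun t => ε i t ω) j * (B *ᵥ fun t => ε i' t ω) j) μ := fun i i' j =>
    (memLp_mulVec B (hε.memLp i) j).integrable_mul (memLp_mulVec B (hε.memLp i') j)
  -- Off-diagonal pairs drop out by uncorrelatedness; the diagonal ones average to one per
  -- coordinate, R in total.
  have hzero : ∀ i i' (j : Fin R), i ≠ i' →
      ∫ ω, (B *ᵥ fun t => ε i t ω) j * (B *ᵥ fun t => ε i' t ω) j ∂μ = 0 := by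
    intro i i' j hii
    rw [integral_mulVec_mul_mulVec B (hε.memLp i) (hε.memLp i')]
    have : Matrix.of (fun t u => ∫ ω, ε i t ω * ε i' u ω ∂μ) = 0 := by
      ext t u
      exact hε.uncorrelated i i' hii t u
    rw [this]; simp
  have hexp : ∀ ω, score B ε ω ⬝ᵥ score B ε ω = (n : ℝ)⁻¹ * ∑ j, ∑ i, ∑ i',
      (B *ᵥ fun t => ε i t ω) j * (B *ᵥ fun t => ε i' t ω) j := by
    intro ω
    rw [score, smul_dotProduct, dotProduct_smul, smul_eq_mul, smul_eq_mul, ← mul_assoc, ← mul_inv,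
      Real.mul_self_sqrt (Nat.cast_nonneg n)]
    simp only [dotProduct, Finset.sum_apply, Finset.sum_mul_sum]
  simp only [hexp]
  rw [integral_const_mul, integral_finsetSum _ fun j _ => integrable_finsetSum _ fun i _ =>
    integrable_finsetSum _ fun i' _ => hint i i' j, Finset.mul_sum]
  have : ∀ j : Fin R, (n : ℝ)⁻¹ * ∫ ω, ∑ i, ∑ i',
      (B *ᵥ fun t => ε i t ω) j * (B *ᵥ fun t => ε i' t ω) j ∂μ = 1 := by
    intro j
    rw [integral_finsetSum _ fun i _ => integrable_finsetSum _ fun i' _ => hint i i' j]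
    have h1 := avg_integral_mulVec_mul hε hB j j
    rw [Matrix.one_apply_eq] at h1
    rw [← h1]
    congr 1
    refine Finset.sum_congr rfl fun i _ => ?_
    rw [integral_finsetSum _ fun i' _ => hint i i' j]
    exact Finset.sum_eq_single_of_mem i (Finset.mem_univ i) fun i' _ h => hzero i i' j h.symm
  simp [this]

/-! ### Fourth-moment bounds and the sampling error of the covariance -/

theorem le_maxMoment_four (i : Fin n) (t : Fin T) :
    ∫ ω, ε i t ω ^ 4 ∂μ ≤ maxMoment μ ε 4 := by
  have h : ∫ ω, ε i t ω ^ 4 ∂μ = ∫ ω, |ε i t ω| ^ (4 : ℝ) ∂μ := by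
    refine integral_congr_ae (.of_forall fun ω => ?_)
    have : (4 : ℝ) = ((4 : ℕ) : ℝ) := by norm_num
    simp only [this, Real.rpow_natCast]
    rw [Even.pow_abs (by decide)]
  rw [h]
  exact le_ciSup (f := fun i : Fin n × Fin T => ∫ ω, |ε i.1 i.2 ω| ^ (4 : ℝ) ∂μ)
    (Set.finite_range _).bddAbove (i, t)

theorem maxMoment_nonneg (μ : Measure Ω) (ε : Fin n → Fin T → Ω → ℝ) (q : ℝ) :
    0 ≤ maxMoment μ ε q :=
  Real.iSup_nonneg fun _ => integral_nonneg fun _ => Real.rpow_nonneg (abs_nonneg _) _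

theorem memLp_two_normSq {m : ℕ} {e : Fin m → Ω → ℝ} (he : ∀ t, MemLp (e t) 4 μ) :
    MemLp (fun ω => (fun t => e t ω) ⬝ᵥ fun t => e t ω) 2 μ := by
  simp only [dotProduct]
  exact memLp_finsetSum _ fun t _ => memLp_two_mul (he t) (he t)

theorem integral_normSq_sq_le (h4 : ∀ i t, MemLp (ε i t) 4 μ) (i : Fin n) :
    ∫ ω, ((fun t => ε i t ω) ⬝ᵥ fun t => ε i t ω) ^ 2 ∂μ ≤ (T : ℝ) ^ 2 * maxMoment μ ε 4 := by
  have hint : ∀ t, Integrable (fun ω => ε i t ω ^ 4) μ := fun t =>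
    (memLp_two_mul (h4 i t) (h4 i t)).integrable_sq.congr (.of_forall fun ω => by
      dsimp only; ring)
  calc ∫ ω, ((fun t => ε i t ω) ⬝ᵥ fun t => ε i t ω) ^ 2 ∂μ
      ≤ ∫ ω, (T : ℝ) * ∑ t, ε i t ω ^ 4 ∂μ := by
        refine integral_mono (memLp_two_normSq (h4 i)).integrable_sq
          ((integrable_finsetSum _ fun t _ => hint t).const_mul _) fun ω => ?_
        -- Cauchy–Schwarz over the T coordinates costs one factor T; summing the T fourth moments
        -- costs the other.
        have h := sq_sum_le_card_mul_sum_sq (s := Finset.univ) (f := fun t => ε i t ω * ε i t ω)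
        simp only [Finset.card_univ, Fintype.card_fin] at h
        refine h.trans_eq ?_
        congr 1
        exact Finset.sum_congr rfl fun t _ => by ring
    _ = (T : ℝ) * ∑ t, ∫ ω, ε i t ω ^ 4 ∂μ := by
        rw [integral_const_mul, integral_finsetSum _ fun t _ => hint t]
    _ ≤ (T : ℝ) * ∑ _t : Fin T, maxMoment μ ε 4 := by
        gcongr with t; exact le_maxMoment_four i t
    _ = (T : ℝ) ^ 2 * maxMoment μ ε 4 := by simp; ring

variable [IsProbabilityMeasure μ]

theorem integral_normSq_le (h4 : ∀ i t, MemLp (ε i t) 4 μ) (i : Fin n) :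
    ∫ ω, ((fun t => ε i t ω) ⬝ᵥ fun t => ε i t ω) ∂μ ≤ T * √(maxMoment μ ε 4) := by
  have hL := memLp_two_normSq (h4 i)
  -- Nonnegativity of the variance serves as Jensen's inequality (E L)² ≤ E L².
  have hv := variance_nonneg (fun ω => (fun t => ε i t ω) ⬝ᵥ fun t => ε i t ω) μ
  rw [variance_eq_sub hL] at hv
  have h := integral_normSq_sq_le h4 i
  refine abs_le_of_sq_le_sq' (a := _) ?_ (by positivity) |>.2
  rw [mul_pow, Real.sq_sqrt (maxMoment_nonneg μ ε 4)]
  refine le_trans ?_ h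
  simpa using hv

/-- R is the average of E|Bε_i|², and B contracts squared lengths up to 1/λ_min(Σ̄). This is what
makes the correction for the estimated mean no larger than the covariance sampling error. -/
theorem card_le_of_standardized (hn : 0 < n) (hε : ErrorMoments μ ε)
    (h4 : ∀ i t, MemLp (ε i t) 4 μ) (hB : B * avgCov μ ε * Bᵀ = 1)
    (hpos : 0 < lambdaMin (avgCov μ ε)) :
    lambdaMin (avgCov μ ε) * R ≤ T * √(maxMoment μ ε 4) := by
  have hn' : (0 : ℝ) < n := by exact_mod_cast hn
  rw [← avg_integral_normSq_mulVec hε hB, mul_left_comm, Finset.mul_sum,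
    inv_mul_le_iff₀ hn']
  calc ∑ i, lambdaMin (avgCov μ ε) *
        ∫ ω, (B *ᵥ fun t => ε i t ω) ⬝ᵥ (B *ᵥ fun t => ε i t ω) ∂μ
      ≤ ∑ _i : Fin n, T * √(maxMoment μ ε 4) := by
        refine Finset.sum_le_sum fun i _ => le_trans ?_ (integral_normSq_le h4 i)
        rw [← integral_const_mul]
        refine integral_mono (Integrable.const_mul ?_ _)
          ((memLp_two_normSq (h4 i)).integrable one_le_two) fun ω =>
          lambdaMin_mul_mulVec_dotProduct_le (avgCov_isHermitian μ ε) hB hpos _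
        exact (memLp_two_normSq (e := fun j ω => (B *ᵥ fun t => ε i t ω) j) fun j =>
          memLp_mulVec B (h4 i) j).integrable one_le_two
    _ = n * (T * √(maxMoment μ ε 4)) := by simp

/-- Sampling error of the empirical second moments of `B ε_i`, when the mean is the identity. -/
noncomputable def covError (B : Matrix (Fin R) (Fin T) ℝ) (ε : Fin n → Fin T → Ω → ℝ) (ω : Ω) :
    Matrix (Fin R) (Fin R) ℝ :=
  (n : ℝ)⁻¹ • ∑ i, vecMulVec (B *ᵥ fun t => ε i t ω) (B *ᵥ fun t => ε i t ω) - 1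

theorem covError_memLp (h4 : ∀ i t, MemLp (ε i t) 4 μ) (j k : Fin R) :
    MemLp (fun ω => covError B ε ω j k) 2 μ := by
  simp only [covError, Matrix.sub_apply, Matrix.smul_apply, Matrix.sum_apply, vecMulVec_apply,
    smul_eq_mul]
  exact ((memLp_finsetSum _ fun i _ => memLp_two_mul (memLp_mulVec B (h4 i) j)
    (memLp_mulVec B (h4 i) k)).const_mul _).sub (memLp_const _)

theorem integrable_frobNorm_covError_sq (h4 : ∀ i t, MemLp (ε i t) 4 μ) :
    Integrable (fun ω => frobNorm (covError B ε ω) ^ 2) μ := by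
  have h : ∀ ω, frobNorm (covError B ε ω) ^ 2 = ∑ j, ∑ k, covError B ε ω j k ^ 2 := fun ω =>
    Real.sq_sqrt (Finset.sum_nonneg fun i _ => Finset.sum_nonneg fun j _ => sq_nonneg _)
  simp only [h]
  exact integrable_finsetSum _ fun j _ => integrable_finsetSum _ fun k _ =>
    (covError_memLp h4 j k).integrable_sq

theorem integral_covError_sq_le (hε : ErrorMoments μ ε)
    (hindep : iIndepFun (fun (i : Fin n) (ω : Ω) (t : Fin T) => ε i t ω) μ)
    (h4 : ∀ i t, MemLp (ε i t) 4 μ) (hB : B * avgCov μ ε * Bᵀ = 1) (j k : Fin R) :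
    ∫ ω, covError B ε ω j k ^ 2 ∂μ ≤ (n : ℝ)⁻¹ ^ 2 *
      ∑ i, ∫ ω, ((B *ᵥ fun t => ε i t ω) j * (B *ᵥ fun t => ε i t ω) k) ^ 2 ∂μ := by
  set Y : Fin n → Ω → ℝ := fun i ω => (B *ᵥ fun t => ε i t ω) j * (B *ᵥ fun t => ε i t ω) k with hY
  have hYL : ∀ i, MemLp (Y i) 2 μ := fun i =>
    memLp_two_mul (memLp_mulVec B (h4 i) j) (memLp_mulVec B (h4 i) k)
  have hYind : ∀ i i', i ≠ i' → Y i ⟂ᵢ[μ] Y i' := by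
    intro i i' hii
    have hg : Measurable fun v : Fin T → ℝ => (B *ᵥ v) j * (B *ᵥ v) k := by
      simp only [mulVec, dotProduct]; fun_prop
    exact (hindep.indepFun hii).comp hg hg
  have hsumL : MemLp (∑ i, Y i) 2 μ := by
    have := memLp_finsetSum Finset.univ (f := Y) (p := 2) (μ := μ) fun i _ => hYL i
    convert this using 1
    ext ω; simp
  have hmean : ∫ ω, (n : ℝ)⁻¹ * (∑ i, Y i) ω ∂μ = (1 : Matrix (Fin R) (Fin R) ℝ) j k := by
    rw [integral_const_mul, ← avg_integral_mulVec_mul hε hB j k]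
    simp only [Finset.sum_apply]
    rw [integral_finsetSum _ fun i _ => (hYL i).integrable one_le_two]
  -- The entry of the identity is exactly the mean of the average, so the second moment is a
  -- variance, additive over independent individuals.
  have hvar : ∫ ω, covError B ε ω j k ^ 2 ∂μ = Var[fun ω => (n : ℝ)⁻¹ * (∑ i, Y i) ω; μ] := by
    rw [variance_eq_integral (hsumL.const_mul _).aemeasurable, hmean]
    refine integral_congr_ae (.of_forall fun ω => ?_)
    simp [covError, Matrix.sum_apply, vecMulVec_apply, hY]
  rw [hvar, variance_const_mul, IndepFun.variance_sum (fun i _ => hYL i)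
    fun i _ i' _ h => hYind i i' h]
  gcongr with i
  exact variance_le_expectation_sq (hYL i).aestronglyMeasurable

theorem integral_frobNorm_covError_sq_le (hn : 0 < n) (hε : ErrorMoments μ ε)
    (hindep : iIndepFun (fun (i : Fin n) (ω : Ω) (t : Fin T) => ε i t ω) μ)
    (h4 : ∀ i t, MemLp (ε i t) 4 μ) (hB : B * avgCov μ ε * Bᵀ = 1)
    (hpos : 0 < lambdaMin (avgCov μ ε)) :
    ∫ ω, frobNorm (covError B ε ω) ^ 2 ∂μ ≤
      (T * √(maxMoment μ ε 4) / (√n * lambdaMin (avgCov μ ε))) ^ 2 := by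
  have hn' : (0 : ℝ) < n := by exact_mod_cast hn
  set lam := lambdaMin (avgCov μ ε) with hlam
  have h : ∀ ω, frobNorm (covError B ε ω) ^ 2 = ∑ j, ∑ k, covError B ε ω j k ^ 2 := fun ω =>
    Real.sq_sqrt (Finset.sum_nonneg fun i _ => Finset.sum_nonneg fun j _ => sq_nonneg _)
  have hYsq : ∀ i j k, Integrable
      (fun ω => ((B *ᵥ fun t => ε i t ω) j * (B *ᵥ fun t => ε i t ω) k) ^ 2) μ := fun i j k =>
    (memLp_two_mul (memLp_mulVec B (h4 i) j) (memLp_mulVec B (h4 i) k)).integrable_sq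
  have hone : ∀ i, ∑ j, ∑ k,
      ∫ ω, ((B *ᵥ fun t => ε i t ω) j * (B *ᵥ fun t => ε i t ω) k) ^ 2 ∂μ ≤
      (T : ℝ) ^ 2 * maxMoment μ ε 4 / lam ^ 2 := by
    intro i
    -- Summing all squared entries of yy' gives |y|⁴, so the bound carries no extra dimension factor
    -- in R.
    have h1 : ∑ j, ∑ k, ∫ ω, ((B *ᵥ fun t => ε i t ω) j * (B *ᵥ fun t => ε i t ω) k) ^ 2 ∂μ =
        ∫ ω, ((B *ᵥ fun t => ε i t ω) ⬝ᵥ (B *ᵥ fun t => ε i t ω)) ^ 2 ∂μ := by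
      have h2 : ∀ ω, ((B *ᵥ fun t => ε i t ω) ⬝ᵥ (B *ᵥ fun t => ε i t ω)) ^ 2 =
          ∑ j, ∑ k, ((B *ᵥ fun t => ε i t ω) j * (B *ᵥ fun t => ε i t ω) k) ^ 2 := by
        intro ω
        rw [sq]
        simp only [dotProduct, Finset.sum_mul_sum]
        exact Finset.sum_congr rfl fun j _ => Finset.sum_congr rfl fun k _ => by ring
      simp only [h2]
      rw [integral_finsetSum _ fun j _ => integrable_finsetSum _ fun k _ => hYsq i j k]
      exact Finset.sum_congr rfl fun j _ => (integral_finsetSum _ fun k _ => hYsq i j k).symm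
    rw [h1, le_div_iff₀ (by positivity)]
    refine le_trans ?_ (integral_normSq_sq_le h4 i)
    rw [← integral_mul_const]
    refine integral_mono (Integrable.mul_const ?_ _) (memLp_two_normSq (h4 i)).integrable_sq
      fun ω => ?_
    · exact (memLp_two_normSq (e := fun j ω => (B *ᵥ fun t => ε i t ω) j) fun j =>
          memLp_mulVec B (h4 i) j).integrable_sq
    · have h3 := lambdaMin_mul_mulVec_dotProduct_le (avgCov_isHermitian μ ε) hB hpos
        fun t => ε i t ω
      have h0 := dotProduct_self_nonneg_real (B *ᵥ fun t => ε i t ω)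
      dsimp only
      rw [← mul_pow, mul_comm]
      exact pow_le_pow_left₀ (mul_nonneg hpos.le h0) h3 2
  simp only [h]
  rw [integral_finsetSum _ fun j _ => integrable_finsetSum _ fun k _ =>
    (covError_memLp h4 j k).integrable_sq]
  calc ∑ j, ∫ ω, ∑ k, covError B ε ω j k ^ 2 ∂μ
      = ∑ j, ∑ k, ∫ ω, covError B ε ω j k ^ 2 ∂μ :=
        Finset.sum_congr rfl fun j _ => integral_finsetSum _ fun k _ =>
          (covError_memLp h4 j k).integrable_sq
    _ ≤ ∑ j, ∑ k, (n : ℝ)⁻¹ ^ 2 *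
        ∑ i, ∫ ω, ((B *ᵥ fun t => ε i t ω) j * (B *ᵥ fun t => ε i t ω) k) ^ 2 ∂μ :=
        Finset.sum_le_sum fun j _ => Finset.sum_le_sum fun k _ =>
          integral_covError_sq_le hε hindep h4 hB j k
    _ = (n : ℝ)⁻¹ ^ 2 * ∑ i, ∑ j, ∑ k,
        ∫ ω, ((B *ᵥ fun t => ε i t ω) j * (B *ᵥ fun t => ε i t ω) k) ^ 2 ∂μ := by
        simp only [← Finset.mul_sum]
        congr 1
        rw [Finset.sum_comm (s := Finset.univ (α := Fin n))]
        exact Finset.sum_congr rfl fun j _ => Finset.sum_comm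
    _ ≤ (n : ℝ)⁻¹ ^ 2 * ∑ _i : Fin n, (T : ℝ) ^ 2 * maxMoment μ ε 4 / lam ^ 2 := by
        gcongr with i; exact hone i
    _ = (T * √(maxMoment μ ε 4) / (√n * lam)) ^ 2 := by
        rw [div_pow, mul_pow, mul_pow, Real.sq_sqrt (maxMoment_nonneg μ ε 4), Real.sq_sqrt hn'.le]
        simp
        field_simp

end Errors

/-! ### The statistic in terms of standardized errors -/

theorem avg_vecMulVec_sub {n R : ℕ} (hn : 0 < n) (a : Fin n → Fin R → ℝ) {b : Fin R → ℝ}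
    (hb : b = (n : ℝ)⁻¹ • ∑ i, a i) :
    (n : ℝ)⁻¹ • ∑ i, vecMulVec (a i - b) (a i - b) =
      (n : ℝ)⁻¹ • ∑ i, vecMulVec (a i) (a i) - vecMulVec b b := by
  have hn' : (n : ℝ) ≠ 0 := by exact_mod_cast hn.ne'
  ext j k
  have hsum : ∀ j, ∑ i, a i j = n * b j := fun j => by
    rw [hb]; simp [Finset.sum_apply, mul_inv_cancel_left₀ hn']
  simp only [Matrix.smul_apply, Matrix.sub_apply, Matrix.sum_apply, vecMulVec_apply, Pi.sub_apply,
    sub_mul, mul_sub, Finset.sum_sub_distrib, ← Finset.mul_sum, ← Finset.sum_mul, hsum, smul_eq_mul]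
  simp only [Finset.sum_const, Finset.card_univ, Fintype.card_fin, nsmul_eq_mul]
  field_simp
  ring

theorem mul_vecMulVec_mul_transpose {R T : ℕ} (B : Matrix (Fin R) (Fin T) ℝ) (u : Fin T → ℝ) :
    B * vecMulVec u u * Bᵀ = vecMulVec (B *ᵥ u) (B *ᵥ u) := by
  rw [mul_vecMulVec, vecMulVec_mul, vecMul_transpose]

section Model

variable {d n T p R : ℕ} {Ω : Type*}

theorem avg_obs (hn : 0 < n) (f : EuclideanSpace ℝ (Fin d) → ℝ)
    (X : Fin T → EuclideanSpace ℝ (Fin d)) (ε : Fin n → Fin T → Ω → ℝ) (ω : Ω) :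
    (n : ℝ)⁻¹ • ∑ i, obs f X ε i ω =
      (fun t => f (X t)) + (n : ℝ)⁻¹ • ∑ i, fun t => ε i t ω := by
  have hn' : (n : ℝ) ≠ 0 := by exact_mod_cast hn.ne'
  ext t
  simp [obs, Finset.sum_apply, Finset.sum_add_distrib, mul_add, inv_mul_cancel_left₀ hn']

/-- The fitted values reproduce Ȳ under `estMatrix`, so f cancels exactly even when it lies outside
the sieve space. -/
theorem estMatrix_mulVec_resid (hn : 0 < n) {f : EuclideanSpace ℝ (Fin d) → ℝ}
    {ψ : Fin p → EuclideanSpace ℝ (Fin d) → ℝ} {X : Fin T → EuclideanSpace ℝ (Fin d)}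
    (hG : ((designMatrix ψ X)ᵀ * designMatrix ψ X).PosDef) (Ψt : Matrix (Fin R) (Fin p) ℝ)
    (ε : Fin n → Fin T → Ω → ℝ) (i : Fin n) (ω : Ω) :
    estMatrix (designMatrix ψ X) Ψt *ᵥ resid f ψ X ε i ω =
      estMatrix (designMatrix ψ X) Ψt *ᵥ ((fun t => ε i t ω) - (n : ℝ)⁻¹ • ∑ i, fun t => ε i t ω) := by
  rw [resid, mulVec_sub, betaHat, estMatrix_mul_design_mulVec_lsCoef hG, ← mulVec_sub,
    avg_obs hn]
  congr 1
  ext t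
  simp [obs]

theorem avgCovHat_isHermitian (f : EuclideanSpace ℝ (Fin d) → ℝ)
    (ψ : Fin p → EuclideanSpace ℝ (Fin d) → ℝ) (X : Fin T → EuclideanSpace ℝ (Fin d))
    (ε : Fin n → Fin T → Ω → ℝ) (ω : Ω) : (avgCovHat f ψ X ε ω).IsHermitian := by
  ext t u
  simp [avgCovHat, Matrix.sum_apply, vecMulVec_apply, mul_comm]

variable [MeasurableSpace Ω] {μ : Measure Ω}

theorem ofLp_centered [IsProbabilityMeasure μ] (hn : 0 < n) (f : EuclideanSpace ℝ (Fin d) → ℝ)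
    (ψ : Fin p → EuclideanSpace ℝ (Fin d) → ℝ) (X : Fin T → EuclideanSpace ℝ (Fin d))
    {ε : Fin n → Fin T → Ω → ℝ} (hε : ErrorMoments μ ε)
    {Λ : (EuclideanSpace ℝ (Fin d) → ℝ) → EuclideanSpace ℝ (Fin R)}
    {Ψt : Matrix (Fin R) (Fin p) ℝ} (hΛ : RepresentedBy ψ Λ Ψt) (ω : Ω) :
    WithLp.ofLp (Λ (fHat f ψ X ε ω) - ∫ ω', Λ (fHat f ψ X ε ω') ∂μ) =
      estMatrix (designMatrix ψ X) Ψt *ᵥ ((n : ℝ)⁻¹ • ∑ i, fun t => ε i t ω) := by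
  set A := estMatrix (designMatrix ψ X) Ψt with hA
  -- Splitting into a constant plus scalar errors times fixed vectors reduces the vector-valued
  -- expectation to scalar means, all zero.
  have hval : ∀ ω, Λ (fHat f ψ X ε ω) = WithLp.toLp 2 (A *ᵥ fun t => f (X t)) +
      ∑ t, ((n : ℝ)⁻¹ * ∑ i, ε i t ω) • WithLp.toLp 2 (A.col t) := by
    intro ω
    rw [fHat, hΛ, betaHat, mulVec_lsCoef, avg_obs hn, ← hA, mulVec_add, WithLp.toLp_add]
    congr 1
    ext j
    simp [mulVec, dotProduct, Finset.sum_apply, mul_comm]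
  have hint : ∀ t, Integrable (fun ω => (n : ℝ)⁻¹ * ∑ i, ε i t ω) μ := fun t =>
    (integrable_finsetSum _ fun i _ => (hε.memLp i t).integrable one_le_two).const_mul _
  have hmean : ∫ ω', Λ (fHat f ψ X ε ω') ∂μ = WithLp.toLp 2 (A *ᵥ fun t => f (X t)) := by
    simp only [hval]
    rw [integral_add (integrable_const _)
      (integrable_finsetSum _ fun t _ => (hint t).smul_const _),
      integral_finsetSum _ fun t _ => (hint t).smul_const _]
    have : ∀ t, ∫ ω, ((n : ℝ)⁻¹ * ∑ i, ε i t ω) • WithLp.toLp 2 (A.col t) ∂μ = 0 := by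
      intro t
      rw [integral_smul_const, integral_const_mul,
        integral_finsetSum _ fun i _ => (hε.memLp i t).integrable one_le_two]
      simp [hε.mean_zero]
    simp [this]
  rw [hmean, hval, add_sub_cancel_left]
  ext j
  simp [mulVec, dotProduct, Finset.sum_apply, mul_comm]

/-- The matrix `(n V)^{-1/2} Ψ̃ (Ψ'Ψ)⁻¹ Ψ'` that standardizes the errors. -/
noncomputable def stdMatrix (μ : Measure Ω) (ψ : Fin p → EuclideanSpace ℝ (Fin d) → ℝ)
    (X : Fin T → EuclideanSpace ℝ (Fin d)) (ε : Fin n → Fin T → Ω → ℝ)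
    (Ψt : Matrix (Fin R) (Fin p) ℝ) : Matrix (Fin R) (Fin T) ℝ :=
  (√n)⁻¹ • (invSqrt (sandwich n (designMatrix ψ X) Ψt (avgCov μ ε)) *
    estMatrix (designMatrix ψ X) Ψt)

theorem stdMatrix_mul_mul_transpose (ψ : Fin p → EuclideanSpace ℝ (Fin d) → ℝ)
    (X : Fin T → EuclideanSpace ℝ (Fin d)) (ε : Fin n → Fin T → Ω → ℝ)
    (Ψt : Matrix (Fin R) (Fin p) ℝ) (M : Matrix (Fin T) (Fin T) ℝ) :
    stdMatrix μ ψ X ε Ψt * M * (stdMatrix μ ψ X ε Ψt)ᵀ =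
      invSqrt (sandwich n (designMatrix ψ X) Ψt (avgCov μ ε)) *
        sandwich n (designMatrix ψ X) Ψt M *
        invSqrt (sandwich n (designMatrix ψ X) Ψt (avgCov μ ε)) := by
  rw [sandwich_eq n _ _ M, stdMatrix]
  simp only [transpose_smul, transpose_mul, invSqrt_transpose, Matrix.smul_mul, Matrix.mul_smul,
    smul_smul, Matrix.mul_assoc]
  rw [← mul_inv, Real.mul_self_sqrt (Nat.cast_nonneg n)]

theorem wBar_avgCov [IsProbabilityMeasure μ] (hn : 0 < n) (f : EuclideanSpace ℝ (Fin d) → ℝ)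
    (ψ : Fin p → EuclideanSpace ℝ (Fin d) → ℝ) (X : Fin T → EuclideanSpace ℝ (Fin d))
    {ε : Fin n → Fin T → Ω → ℝ} (hε : ErrorMoments μ ε)
    {Λ : (EuclideanSpace ℝ (Fin d) → ℝ) → EuclideanSpace ℝ (Fin R)}
    {Ψt : Matrix (Fin R) (Fin p) ℝ} (hΛ : RepresentedBy ψ Λ Ψt) (ω : Ω) :
    wBar μ f ψ X ε Λ Ψt (avgCov μ ε) ω = score (stdMatrix μ ψ X ε Ψt) ε ω := by
  rw [wBar, ofLp_centered hn f ψ X hε hΛ, score, stdMatrix, ← mulVec_sum, smul_mulVec, smul_smul,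
    ← mul_inv, Real.mul_self_sqrt (Nat.cast_nonneg n), mulVec_mulVec, mulVec_smul]

theorem standardized_avgCovHat (hn : 0 < n) {f : EuclideanSpace ℝ (Fin d) → ℝ}
    {ψ : Fin p → EuclideanSpace ℝ (Fin d) → ℝ} {X : Fin T → EuclideanSpace ℝ (Fin d)}
    (hG : ((designMatrix ψ X)ᵀ * designMatrix ψ X).PosDef) (Ψt : Matrix (Fin R) (Fin p) ℝ)
    (ε : Fin n → Fin T → Ω → ℝ) (ω : Ω) :
    stdMatrix μ ψ X ε Ψt * avgCovHat f ψ X ε ω * (stdMatrix μ ψ X ε Ψt)ᵀ - 1 =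
      covError (stdMatrix μ ψ X ε Ψt) ε ω - (n : ℝ)⁻¹ •
        vecMulVec (score (stdMatrix μ ψ X ε Ψt) ε ω) (score (stdMatrix μ ψ X ε Ψt) ε ω) := by
  set B := stdMatrix μ ψ X ε Ψt with hB
  set b : Fin R → ℝ := (√n)⁻¹ • score B ε ω with hb
  have hb' : b = (n : ℝ)⁻¹ • ∑ i, B *ᵥ fun t => ε i t ω := by
    rw [hb, score, smul_smul, ← mul_inv, Real.mul_self_sqrt (Nat.cast_nonneg n)]
  have hres : ∀ i, B *ᵥ resid f ψ X ε i ω = (B *ᵥ fun t => ε i t ω) - b := by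
    intro i
    rw [hb', ← mulVec_sum, ← mulVec_smul, ← mulVec_sub, hB, stdMatrix, smul_mulVec, smul_mulVec,
      ← mulVec_mulVec, ← mulVec_mulVec, estMatrix_mulVec_resid hn hG]
  rw [avgCovHat, Matrix.mul_smul, Matrix.smul_mul, Matrix.mul_sum, Matrix.sum_mul]
  simp only [mul_vecMulVec_mul_transpose, hres]
  rw [avg_vecMulVec_sub hn _ hb', covError, hb, smul_vecMulVec, vecMulVec_smul, smul_smul,
    ← mul_inv, Real.mul_self_sqrt (Nat.cast_nonneg n)]
  abel

theorem abs_stdWaldHat_sub_le [IsProbabilityMeasure μ] (hn : 0 < n)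
    {f : EuclideanSpace ℝ (Fin d) → ℝ}
    {ψ : Fin p → EuclideanSpace ℝ (Fin d) → ℝ} {X : Fin T → EuclideanSpace ℝ (Fin d)}
    (hG : ((designMatrix ψ X)ᵀ * designMatrix ψ X).PosDef)
    {ε : Fin n → Fin T → Ω → ℝ} (hε : ErrorMoments μ ε)
    {Λ : (EuclideanSpace ℝ (Fin d) → ℝ) → EuclideanSpace ℝ (Fin R)}
    {Ψt : Matrix (Fin R) (Fin p) ℝ} (hΨt : (Ψt * Ψtᵀ).PosDef) (hΛ : RepresentedBy ψ Λ Ψt)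
    {δ : ℝ} (hδ : δ ≤ 1 / 2) (ω : Ω)
    (hω : frobNorm (covError (stdMatrix μ ψ X ε Ψt) ε ω) + (n : ℝ)⁻¹ *
      (score (stdMatrix μ ψ X ε Ψt) ε ω ⬝ᵥ score (stdMatrix μ ψ X ε Ψt) ε ω) ≤ δ) :
    |stdWaldHat μ f ψ X ε Λ Ψt ω - stdWald μ f ψ X ε Λ Ψt ω| ≤
      2 * δ * (score (stdMatrix μ ψ X ε Ψt) ε ω ⬝ᵥ score (stdMatrix μ ψ X ε Ψt) ε ω) /
        √(2 * R) := by
  have hV := sandwich_posDef hn hG hΨt (avgCov_posDef hn hε)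
  set w := score (stdMatrix μ ψ X ε Ψt) ε ω with hw
  have hbound : ∀ x y : Fin R → ℝ,
      |x ⬝ᵥ (invSqrt (sandwich n (designMatrix ψ X) Ψt (avgCov μ ε)) *
        sandwich n (designMatrix ψ X) Ψt (avgCovHat f ψ X ε ω) *
        invSqrt (sandwich n (designMatrix ψ X) Ψt (avgCov μ ε)) - 1) *ᵥ y| ≤
      δ * (√(x ⬝ᵥ x) * √(y ⬝ᵥ y)) := by
    intro x y
    have hn0 : (0 : ℝ) ≤ (n : ℝ)⁻¹ := by positivity
    rw [← stdMatrix_mul_mul_transpose, standardized_avgCovHat hn hG, ← hw, sub_mulVec,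
      dotProduct_sub]
    have h1 := abs_dotProduct_mulVec_le (covError (stdMatrix μ ψ X ε Ψt) ε ω) x y
    have h2 : |x ⬝ᵥ ((n : ℝ)⁻¹ • vecMulVec w w) *ᵥ y| ≤
        (n : ℝ)⁻¹ * (w ⬝ᵥ w) * (√(x ⬝ᵥ x) * √(y ⬝ᵥ y)) := by
      have h3 : x ⬝ᵥ ((n : ℝ)⁻¹ • vecMulVec w w) *ᵥ y = (n : ℝ)⁻¹ * ((x ⬝ᵥ w) * (w ⬝ᵥ y)) := by
        rw [smul_mulVec, dotProduct_smul, smul_eq_mul, vecMulVec_mulVec]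
        simp [dotProduct_smul, mul_comm]
      rw [h3, abs_mul, abs_mul, abs_of_nonneg hn0]
      calc (n : ℝ)⁻¹ * (|x ⬝ᵥ w| * |w ⬝ᵥ y|)
          ≤ (n : ℝ)⁻¹ * ((√(x ⬝ᵥ x) * √(w ⬝ᵥ w)) * (√(w ⬝ᵥ w) * √(y ⬝ᵥ y))) := by
            gcongr <;> exact abs_dotProduct_le _ _
        _ = (n : ℝ)⁻¹ * (√(w ⬝ᵥ w) * √(w ⬝ᵥ w)) * (√(x ⬝ᵥ x) * √(y ⬝ᵥ y)) := by ring
        _ = _ := by rw [Real.mul_self_sqrt (dotProduct_self_nonneg_real w)]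
    refine (abs_sub _ _).trans ((add_le_add h1 h2).trans ?_)
    rw [← add_mul]
    gcongr
  have h := abs_wald_sub_le hV
    (sandwich_isHermitian n (designMatrix ψ X) Ψt (avgCovHat_isHermitian f ψ X ε ω)) hδ hbound
    (WithLp.ofLp (Λ (fHat f ψ X ε ω) - ∫ ω', Λ (fHat f ψ X ε ω') ∂μ))
  have hwB := wBar_avgCov hn f ψ X hε hΛ ω
  rw [← hw] at hwB
  rw [stdWaldHat, stdWald, ← sub_div, sub_sub_sub_cancel_right, abs_div,
    abs_of_nonneg (Real.sqrt_nonneg _), ← hwB]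
  exact div_le_div_of_nonneg_right h (Real.sqrt_nonneg _)

/-! ### The tail bound and the theorem -/

theorem measure_stdWaldHat_sub_le [IsProbabilityMeasure μ] (hn : 0 < n) (hT : 0 < T) (hR : 0 < R)
    {f : EuclideanSpace ℝ (Fin d) → ℝ}
    {ψ : Fin p → EuclideanSpace ℝ (Fin d) → ℝ} {X : Fin T → EuclideanSpace ℝ (Fin d)}
    (hG : ((designMatrix ψ X)ᵀ * designMatrix ψ X).PosDef)
    {ε : Fin n → Fin T → Ω → ℝ} (hε : ErrorMoments μ ε)
    (hindep : iIndepFun (fun (i : Fin n) (ω : Ω) (t : Fin T) => ε i t ω) μ)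
    (h4 : ∀ i t, MemLp (ε i t) 4 μ)
    {Λ : (EuclideanSpace ℝ (Fin d) → ℝ) → EuclideanSpace ℝ (Fin R)}
    {Ψt : Matrix (Fin R) (Fin p) ℝ} (hΨt : (Ψt * Ψtᵀ).PosDef) (hΛ : RepresentedBy ψ Λ Ψt)
    {K ρ : ℝ} (hK : 1 ≤ K)
    (hρ : ρ = T * √(maxMoment μ ε 4) / (√n * lambdaMin (avgCov μ ε))) (hKρ : 4 * K * ρ ≤ 1) :
    μ {ω | 4 * K ^ 2 * (ρ * √R) < |stdWaldHat μ f ψ X ε Λ Ψt ω - stdWald μ f ψ X ε Λ Ψt ω|} ≤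
      ENNReal.ofReal (2 / K) := by
  set B := stdMatrix μ ψ X ε Ψt with hBdef
  have hn' : (0 : ℝ) < n := by exact_mod_cast hn
  have hR' : (0 : ℝ) < R := by exact_mod_cast hR
  have hK0 : 0 < K := one_pos.trans_le hK
  have hlam := lambdaMin_pos hT (avgCov_posDef hn hε)
  have hB : B * avgCov μ ε * Bᵀ = 1 := by
    rw [hBdef, stdMatrix_mul_mul_transpose]
    exact invSqrt_mul_mul_invSqrt (sandwich_posDef hn hG hΨt (avgCov_posDef hn hε))
  have hcard := card_le_of_standardized hn hε h4 hB hlam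
  have hRn : (R : ℝ) / √n ≤ ρ := by
    rw [hρ, div_le_div_iff₀ (by positivity) (by positivity)]
    nlinarith [Real.sqrt_nonneg (n : ℝ)]
  have hρ0 : 0 < ρ := (by positivity : (0 : ℝ) < R / √n).trans_le hRn
  have hRn2 : (n : ℝ)⁻¹ * R ≤ ρ := by
    refine le_trans ?_ hRn
    rw [inv_mul_eq_div]
    refine div_le_div_of_nonneg_left hR'.le (by positivity) ?_
    refine Real.sqrt_le_iff.2 ⟨hn'.le, ?_⟩
    have : (1 : ℝ) ≤ n := by exact_mod_cast hn
    nlinarith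
  -- Outside these two events |w|² < KR and ‖D‖_F < Kρ, so both parts of the perturbation are at
  -- most Kρ. Each event has probability at most 1/K.
  set E₁ := {ω | K * R ≤ score B ε ω ⬝ᵥ score B ε ω} with hE₁
  set E₂ := {ω | K ^ 2 * ρ ^ 2 ≤ frobNorm (covError B ε ω) ^ 2} with hE₂
  have hP₁ : μ.real E₁ ≤ 1 / K := by
    have h := mul_meas_ge_le_integral_of_nonneg
      (.of_forall fun ω => dotProduct_self_nonneg_real (score B ε ω))
      (integrable_normSq_score (B := B) hε) (K * R)
    rw [integral_normSq_score hε hB] at h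
    rw [le_div_iff₀ hK0]
    refine le_of_mul_le_mul_right ?_ hR'
    calc μ.real E₁ * K * R = K * R * μ.real E₁ := by ring
      _ ≤ 1 * R := by rw [one_mul]; exact h
  have hP₂ : μ.real E₂ ≤ 1 / K := by
    have h := (mul_meas_ge_le_integral_of_nonneg (.of_forall fun ω => sq_nonneg _)
      (integrable_frobNorm_covError_sq (μ := μ) (B := B) h4) (K ^ 2 * ρ ^ 2)).trans
      (integral_frobNorm_covError_sq_le hn hε hindep h4 hB hlam)
    rw [← hρ] at h
    have h1 : K ^ 2 * μ.real E₂ ≤ 1 := by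
      refine le_of_mul_le_mul_right ?_ (pow_pos hρ0 2)
      calc K ^ 2 * μ.real E₂ * ρ ^ 2 = K ^ 2 * ρ ^ 2 * μ.real E₂ := by ring
        _ ≤ 1 * ρ ^ 2 := by rw [one_mul]; exact h
    have h2 : 0 ≤ μ.real E₂ := measureReal_nonneg
    rw [le_div_iff₀ hK0]
    -- Chebyshev gives 1/K²; K ≥ 1 weakens it to 1/K.
    nlinarith [mul_nonneg h2 hK0.le]
  have hsub : {ω | 4 * K ^ 2 * (ρ * √R) <
      |stdWaldHat μ f ψ X ε Λ Ψt ω - stdWald μ f ψ X ε Λ Ψt ω|} ⊆ E₁ ∪ E₂ := by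
    intro ω hω
    by_contra hcon
    simp only [hE₁, hE₂, Set.mem_union, Set.mem_ofPred_eq, not_or, not_le] at hcon hω
    obtain ⟨h1, h2⟩ := hcon
    rw [← mul_pow] at h2
    have h3 : frobNorm (covError B ε ω) < K * ρ := lt_of_pow_lt_pow_left₀ 2 (by positivity) h2
    have h4 : (n : ℝ)⁻¹ * (score B ε ω ⬝ᵥ score B ε ω) ≤ K * ρ := by
      calc (n : ℝ)⁻¹ * (score B ε ω ⬝ᵥ score B ε ω) ≤ (n : ℝ)⁻¹ * (K * R) := by gcongr
        _ = K * ((n : ℝ)⁻¹ * R) := by ring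
        _ ≤ K * ρ := by gcongr
    -- The choice δ = 2Kρ adds the two bounds; the requirement δ ≤ 1/2 is the hypothesis 4Kρ ≤ 1.
    have h5 := abs_stdWaldHat_sub_le (f := f) hn hG hε hΨt hΛ (δ := 2 * K * ρ) (by linarith) ω
      (by rw [← hBdef]; linarith)
    rw [← hBdef] at h5
    refine absurd hω (not_lt.2 (h5.trans ?_))
    have hsq : 0 < √(R : ℝ) := Real.sqrt_pos.2 hR'
    calc 2 * (2 * K * ρ) * (score B ε ω ⬝ᵥ score B ε ω) / √(2 * R)
        ≤ 2 * (2 * K * ρ) * (K * R) / √R := by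
          gcongr
          linarith
      _ = 4 * K ^ 2 * (ρ * (R / √R)) := by ring
      _ = 4 * K ^ 2 * (ρ * √R) := by rw [Real.div_sqrt]
  calc _ ≤ μ (E₁ ∪ E₂) := measure_mono hsub
    _ = ENNReal.ofReal (μ.real (E₁ ∪ E₂)) := by simp
    _ ≤ ENNReal.ofReal (2 / K) := by
      refine ENNReal.ofReal_le_ofReal ((measureReal_union_le _ _).trans ?_)
      linarith [show 2 / K = 1 / K + 1 / K by ring]

end Model

theorem theorem4
    {ι : Type*} (l : Filter ι)
    -- numbers of individuals, tasks, basis functions and restrictions along the asymptotics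
    (n T P R : ι → ℕ)
    (hn : Tendsto n l atTop) (hT : Tendsto T l atTop) (hR : ∀ k, 0 < R k)
    -- stimuli, regression function, sieve basis
    {d : ℕ} (S : Set (EuclideanSpace ℝ (Fin d))) (hS : IsCompact S)
    (f : EuclideanSpace ℝ (Fin d) → ℝ)
    (ψ : ∀ p : ℕ, Fin p → EuclideanSpace ℝ (Fin d) → ℝ)
    (X : ∀ k, Fin (T k) → EuclideanSpace ℝ (Fin d)) (hX : ∀ k t, X k t ∈ S)
    -- errors
    {Ω : ι → Type*} [∀ k, MeasurableSpace (Ω k)]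
    (μ : ∀ k, Measure (Ω k)) [∀ k, IsProbabilityMeasure (μ k)]
    (ε : ∀ k, Fin (n k) → Fin (T k) → Ω k → ℝ)
    (hε : ∀ k, ErrorMoments (μ k) (ε k))
    (hindep : ∀ k, iIndepFun (fun (i : Fin (n k)) (ω : Ω k) (t : Fin (T k)) => ε k i t ω) (μ k))
    -- design, basis and consistency assumptions; smoothness of `f`
    (hdesign : DesignConverges l T P ψ X) (hbasis : BasisRegular S ψ)
    (s c : ℕ) (hsc : s ≤ c)
    (hrates : ConsistencyRates l S s n T P μ f ψ X ε) (hf : MemSob S c f)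
    -- the functional `Γ`, and the linear functional `Λ` that enters the statistic:
    -- `Λ = Γ` in the linear case and `Λ = Γ'(·; f)` in the nonlinear case
    (Γ Λ : ∀ k, (EuclideanSpace ℝ (Fin d) → ℝ) → EuclideanSpace ℝ (Fin (R k)))
    (Ψt : ∀ k, Matrix (Fin (R k)) (Fin (P k)) ℝ)
    (hΨt : ∀ k, 0 < lambdaMin (Ψt k * (Ψt k)ᵀ))
    (hΓ : ((∀ k, LinearFunctional S s (ψ (P k)) (Γ k) (Ψt k)) ∧ Λ = Γ) ∨
      (LyapunovCondition l n T μ ε ∧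
        ∃ DΓ : ∀ k, (EuclideanSpace ℝ (Fin d) → ℝ) → (EuclideanSpace ℝ (Fin d) → ℝ) →
            EuclideanSpace ℝ (Fin (R k)),
          (∀ k, NonlinearFunctional S s f (ψ (P k)) (Γ k) (DΓ k) (Ψt k)) ∧
          Λ = fun k g => DΓ k g f))
    -- finite fourth moments and the rate condition
    (hfour : ∀ᶠ k in l, ∀ i t, MemLp (ε k i t) 4 (μ k))
    (hcond : Tendsto (fun k => condGram (Ψt k) *
      (T k * max 1 (Real.log (R k)) * √(maxMoment (μ k) (ε k) 4) /
        (√(n k) * lambdaMin (avgCov (μ k) (ε k))))) l (𝓝 0)) :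
    IsBigOP l μ
      (fun k ω => stdWaldHat (μ k) f (ψ (P k)) (X k) (ε k) (Λ k) (Ψt k) ω -
        stdWald (μ k) f (ψ (P k)) (X k) (ε k) (Λ k) (Ψt k) ω)
      (fun k => condGram (Ψt k) *
        (T k * √(R k) * max 1 (Real.log (R k)) * √(maxMoment (μ k) (ε k) 4) /
          (lambdaMin (avgCov (μ k) (ε k)) * √(n k)))) := by
  have hrep : ∀ k, RepresentedBy (ψ (P k)) (Λ k) (Ψt k) := by
    rcases hΓ with ⟨h, rfl⟩ | ⟨-, DΓ, h, rfl⟩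
    · exact fun k => (h k).represented
    · exact fun k => (h k).represented
  obtain ⟨Q, hQ, ⟨q, hq, hqQ⟩, hQlim⟩ := hdesign
  set ρ : ι → ℝ := fun k =>
    T k * √(maxMoment (μ k) (ε k) 4) / (√(n k) * lambdaMin (avgCov (μ k) (ε k))) with hρ
  have hfactor : ∀ k, 1 ≤ condGram (Ψt k) * max 1 (Real.log (R k)) := fun k =>
    one_le_mul_of_one_le_of_one_le (one_le_condGram (hR k) (hΨt k)) (le_max_left _ _)
  intro η hη
  -- Chosen so that the tail probability 2/K is at most η.
  set K : ℝ := max 1 (2 / η) with hKdef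
  have hK : 1 ≤ K := le_max_left _ _
  have hK0 : 0 < K := one_pos.trans_le hK
  refine ⟨4 * K ^ 2, by positivity, ?_⟩
  filter_upwards [hn.eventually_gt_atTop 0, hT.eventually_gt_atTop 0, hfour,
    hQlim.eventually (gt_mem_nhds hq),
    hcond.eventually (gt_mem_nhds (by positivity : (0 : ℝ) < 1 / (4 * K)))]
    with k hnk hTk h4k hQk hck
  have hlam := lambdaMin_pos hTk (avgCov_posDef hnk (hε k))
  have hρ0 : 0 ≤ ρ k := by
    simp only [hρ]
    positivity
  -- The rate condition bounds ρ times a factor that is at least 1, hence bounds ρ itself.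
  have hKρ : 4 * K * ρ k ≤ 1 := by
    have h1 : ρ k ≤ 1 / (4 * K) := by
      refine (le_mul_of_one_le_left hρ0 (hfactor k)).trans (le_of_eq_of_le ?_ hck.le)
      simp only [hρ]
      ring
    rwa [le_div_iff₀ (by positivity), mul_comm] at h1
  refine le_trans (measure_mono ?_) ((measure_stdWaldHat_sub_le (f := f) hnk hTk (hR k)
    (posDef_gram_of_frobNorm_lt _ (hQ k).1 (hQk.trans_le (hqQ k))) (hε k) (hindep k) h4k
    (posDef_of_lambdaMin_pos (isHermitian_mul_transpose _) (hΨt k)) (hrep k) hK rfl hKρ).trans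
    (ENNReal.ofReal_le_ofReal ?_))
  · intro ω hω
    rw [Set.mem_ofPred_eq] at hω ⊢
    refine lt_of_le_of_lt ?_ hω
    refine mul_le_mul_of_nonneg_left (le_trans ?_ (le_abs_self _)) (by positivity)
    refine (le_mul_of_one_le_left (by positivity) (hfactor k)).trans_eq ?_
    ring
  · rw [div_le_iff₀ hK0, mul_comm, ← div_le_iff₀ hη]
    exact le_max_right _ _
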